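/- Let $\mathbb K$ be a field of characteristic zero. A multiquiver $\Gamma=(V,E,s,t)$ consists of sets $V$ (vertices) and $E$ (edges), possibly empty or infinite, and maps $s,t:E\to (V\times\mathbb Z_{>0})\cup\{\emptyset\}$ such that $u\neq v$ whenever $s(e)=(u,m)$ and $t(e)=(v,n)$, and such that for every $v\in V$ only finitely many edges $e$ satisfy $s(e)\in\{v\}\times\mathbb Z_{>0}$ or $t(e)\in\{v\}\times\mathbb Z_{>0}$; such a $v$ is then called incident to $e$. Its incidence matrix is the homomorphism of free abelian groups $\gamma:\mathbb ZV\to\mathbb ZE$, $\gamma(v)=\sum_{e}\gamma_{ev}e$, with $\gamma_{ev}=n$ if $t(e)=(v,n)$, $\gamma_{ev}=-n$ if $s(e)=(v,n)$, and $\gamma_{ev}=0$ otherwise. *The algebra $\mathcal A(\Gamma)$.* Let $R_E=\mathbb K[u_e\mid e\in E]$. For $v\in V$ let $\sigma_v$ be the automorphism of the $\mathbb K$-algebra $R_E$ with $\sigma_v(u_e)=u_e-\gamma_{ev}$, and let $t_v=\prod_{e}u_{ev}$, the product over all edges $e$ incident to $v$, where $u_{ev}=u_e(u_e+1)\cdots(u_e+n-1)$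 if $t(e)=(v,n)$ and $u_{ev}=(u_e-1)(u_e-2)\cdots(u_e-n)$ if $s(e)=(v,n)$. Let $\mathcal C$ be the $R_E$-ring generated by $X_v,Y_v$ $(v\in V)$ subject to the relations $X_vr=\sigma_v(r)X_v$, $Y_vr=\sigma_v^{-1}(r)Y_v$ $(r\in R_E)$, $Y_vX_v=t_v$, $X_vY_v=\sigma_v(t_v)$, and $X_vY_w=Y_wX_v$ for $v\ne w$. It is $\mathbb ZV$-graded by $\deg r=0$, $\deg X_v=v$, $\deg Y_v=-v$. Then $\mathcal A(\Gamma)$ is the quotient of $\mathcal C$ by the sum of all graded two-sided ideals having zero intersection with the degree zero component $\mathcal C_0$ (a twisted generalized Weyl algebra). Below, "$R_E$ in $\mathcal A(\Gamma)$" means the image of the canonical map $R_E\to\mathcal A(\Gamma)$. *The canonical representation.* Let $A_E(\mathbb K)$ be the Weyl algebra, generated by $x_e,y_e$ $(e\in E)$ with relations $[x_e,x_f]=[y_e,y_f]=0$, $[y_e,x_f]=\delta_{ef}$. For $k=\sum_e k_e e\in\mathbb ZE$ put $z^k=\prod_{e}z_e^{(k_e)}$, where $z_e^{(p)}=x_e^p$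 for $p\ge0$ and $z_e^{(p)}=y_e^{-p}$ for $p<0$. *Equilibrium.* A leaf is an edge $e$ with $s(e)=\emptyset$ or $t(e)=\emptyset$. A subgraph of $\Gamma$ is given by subsets $V'\subseteq V$, $E'\subseteq E$ and the restrictions of $s,t$ to $E'$, where values whose vertex is not in $V'$ are replaced by $\emptyset$. A directed cycle is a multiquiver with enumerations $V=\{v_1,\dots,v_n\}$, $E=\{e_1,\dots,e_n\}$ without repetition ($n\ge1$) such that $s(e_i)=(v_i,a_i)$ and $t(e_i)=(v_{i+1},b_i)$ for all $i$, with $v_{n+1}=v_1$; it is balanced if $\prod_i a_i=\prod_i b_i$. An NND (not necessarily directed) cycle is a multiquiver that becomes isomorphic to a directed cycle after reversing some of its edges, that is, interchanging $s(e)$ and $t(e)$ for some edges $e$; it is balanced if it becomes isomorphic in this way to a balanced directed cycle. Connected components are taken with respect to incidence of vertices and edges (an edge with neither source nor target is a component by itself). A connected component $C$ of $\Gamma$ is in equilibrium if it has finitely many vertices and no leaves, and every subgraph of $C$ that is an NND cycle is balanced. **Theorem.** Let $\Gamma=(V,E,s,t)$ be a multiquiver. There is a unique homomorphism of $\mathbb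 K$-algebras $\varphi_\Gamma:\mathcal A(\Gamma)\to A_E(\mathbb K)$ with $\varphi_\Gamma(X_v)=z^{\gamma(v)}$, $\varphi_\Gamma(Y_v)=z^{-\gamma(v)}$ for $v\in V$ and $\varphi_\Gamma(u_e)=y_ex_e$ for $e\in E$ (the canonical representation by differential operators), and the following statements are equivalent: 1. $\varphi_\Gamma$ is injective; 2. $\gamma$ is injective; 3. $R_E$ is a maximal commutative subalgebra of $\mathcal A(\Gamma)$; 4. no connected component of $\Gamma$ is in equilibrium. -/

import Mathlib

noncomputable section

/-! ### Twisted generalized Weyl algebras -/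

/-- A twisted generalized Weyl datum `(R, σ, t)` over `K` with index set `I`. -/
structure TGWDatum (K R I : Type*) [Field K] [Ring R] [Algebra K R] where
  /-- the commuting automorphisms -/
  σ : I → R ≃ₐ[K] R
  /-- the nonzero central elements -/
  t : I → R
  σ_comm : ∀ i j r, σ i (σ j r) = σ j (σ i r)
  t_ne_zero : ∀ i, t i ≠ 0
  t_central : ∀ i r, t i * r = r * t i

/-- Generators of the twisted generalized Weyl construction: the elements of `R`, and symbols
`X i`, `Y i` for `i : I`. -/
inductive TGWGen (R I : Type*) where
  | coeff (r : R) : TGWGen R I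
  | X (i : I) : TGWGen R I
  | Y (i : I) : TGWGen R I

/-- The degree in `ℤ I` of a generator: `deg r = 0`, `deg X i = i`, `deg Y i = -i`. -/
def TGWGen.deg {R I : Type*} : TGWGen R I → (I →₀ ℤ)
  | .coeff _ => 0
  | .X i => Finsupp.single i 1
  | .Y i => -Finsupp.single i 1

namespace TGWDatum

variable {K R I : Type*} [Field K] [Ring R] [Algebra K R]

/-- Defining relations of the twisted generalized Weyl construction. The first three say that
`R` maps to the quotient by a homomorphism of `K`-algebras, so that the quotient is the quotient of
the free `R`-ring on the `X i`, `Y i` by the remaining relations (these force `K` to be central). -/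
inductive Rel (D : TGWDatum K R I) (μ : I → I → Kˣ) :
    FreeAlgebra K (TGWGen R I) → FreeAlgebra K (TGWGen R I) → Prop
  | coeff_add (r s : R) : Rel D μ (FreeAlgebra.ι K (.coeff (r + s)))
      (FreeAlgebra.ι K (.coeff r) + FreeAlgebra.ι K (.coeff s))
  | coeff_mul (r s : R) : Rel D μ (FreeAlgebra.ι K (.coeff (r * s)))
      (FreeAlgebra.ι K (.coeff r) * FreeAlgebra.ι K (.coeff s))
  | coeff_algebraMap (k : K) : Rel D μ (FreeAlgebra.ι K (.coeff (algebraMap K R k)))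
      (algebraMap K (FreeAlgebra K (TGWGen R I)) k)
  | X_coeff (i : I) (r : R) : Rel D μ (FreeAlgebra.ι K (.X i) * FreeAlgebra.ι K (.coeff r))
      (FreeAlgebra.ι K (.coeff (D.σ i r)) * FreeAlgebra.ι K (.X i))
  | Y_coeff (i : I) (r : R) : Rel D μ (FreeAlgebra.ι K (.Y i) * FreeAlgebra.ι K (.coeff r))
      (FreeAlgebra.ι K (.coeff ((D.σ i).symm r)) * FreeAlgebra.ι K (.Y i))
  | Y_X (i : I) : Rel D μ (FreeAlgebra.ι K (.Y i) * FreeAlgebra.ι K (.X i))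
      (FreeAlgebra.ι K (.coeff (D.t i)))
  | X_Y (i : I) : Rel D μ (FreeAlgebra.ι K (.X i) * FreeAlgebra.ι K (.Y i))
      (FreeAlgebra.ι K (.coeff (D.σ i (D.t i))))
  | X_Y_ne (i j : I) (h : i ≠ j) : Rel D μ (FreeAlgebra.ι K (.X i) * FreeAlgebra.ι K (.Y j))
      ((μ i j : K) • (FreeAlgebra.ι K (.Y j) * FreeAlgebra.ι K (.X i)))

variable (D : TGWDatum K R I) (μ : I → I → Kˣ)

/-- The twisted generalized Weyl construction `C_μ(R, σ, t)`. The diagonal of `μ` is not used. -/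
abbrev Construction : Type _ := RingQuot (D.Rel μ)

/-- The image of a generator in the construction. -/
def Construction.gen (g : TGWGen R I) : D.Construction μ :=
  RingQuot.mkAlgHom K (D.Rel μ) (FreeAlgebra.ι K g)

/-- The component of degree `d` of the construction: the span of the words of degree `d` in the
generators. -/
def Construction.component (d : I →₀ ℤ) : Submodule K (D.Construction μ) :=
  Submodule.span K {x | ∃ w : List (TGWGen R I),
    (w.map TGWGen.deg).sum = d ∧ (w.map (Construction.gen D μ)).prod = x}

/-- An ideal is graded if it is spanned by its homogeneous elements. -/
def IsGradedIdeal (J : Ideal (D.Construction μ)) : Prop :=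
  ∀ a ∈ J, a ∈ Submodule.span K {b | b ∈ J ∧ ∃ d, b ∈ Construction.component D μ d}

/-- The sum of all graded two-sided ideals having zero intersection with the component of
degree zero. -/
def radicalIdeal : Ideal (D.Construction μ) :=
  sSup {J | J.IsTwoSided ∧ D.IsGradedIdeal μ J ∧
    ∀ a ∈ J, a ∈ Construction.component D μ 0 → a = 0}

instance radicalIdeal_isTwoSided : (D.radicalIdeal μ).IsTwoSided where
  mul_mem_of_left {a} b ha := by
    unfold radicalIdeal at ha ⊢
    rw [sSup_eq_iSup'] at ha ⊢
    refine Submodule.iSup_induction (motive := fun x => x * b ∈ _) _ ha ?_ (by simp) ?_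
    · intro J x hx
      have := J.2.1
      exact Submodule.mem_iSup_of_mem J (Ideal.IsTwoSided.mul_mem_of_left b hx)
    · intro x y hx hy
      rw [add_mul]
      exact add_mem hx hy

/-- The twisted generalized Weyl algebra `A_μ(R, σ, t)`. -/
abbrev TGWAlgebra : Type _ := D.Construction μ ⧸ D.radicalIdeal μ

/-- The image of a generator in the twisted generalized Weyl algebra. -/
def TGWAlgebra.gen (g : TGWGen R I) : D.TGWAlgebra μ :=
  Ideal.Quotient.mk (D.radicalIdeal μ) (Construction.gen D μ g)

/-- The canonical homomorphism `ρ : R → A_μ(R, σ, t)`. -/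
def TGWAlgebra.ρ : R →ₐ[K] D.TGWAlgebra μ :=
  (Ideal.Quotient.mkₐ K (D.radicalIdeal μ)).comp <|
    AlgHom.ofLinearMap
      { toFun := fun r => Construction.gen D μ (.coeff r)
        map_add' := fun r s => by
          simpa [Construction.gen] using RingQuot.mkAlgHom_rel K (Rel.coeff_add (D := D) (μ := μ) r s)
        map_smul' := fun k r => by
          have h₁ := RingQuot.mkAlgHom_rel K
            (Rel.coeff_mul (D := D) (μ := μ) (algebraMap K R k) r)
          have h₂ := RingQuot.mkAlgHom_rel K (Rel.coeff_algebraMap (D := D) (μ := μ) k)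
          rw [map_mul, h₂, AlgHom.commutes, ← Algebra.smul_def, ← Algebra.smul_def] at h₁
          exact h₁ }
      (by
        have h := RingQuot.mkAlgHom_rel K (Rel.coeff_algebraMap (D := D) (μ := μ) 1)
        simpa [Construction.gen] using h)
      (fun r s => by
        simpa [Construction.gen] using RingQuot.mkAlgHom_rel K (Rel.coeff_mul (D := D) (μ := μ) r s))

end TGWDatum

/-! ### The Weyl algebra -/

/-- Generators of the Weyl algebra with index set `E`. -/
inductive WeylGen (E : Type*) where
  | x (e : E) : WeylGen E
  | y (e : E) : WeylGen E

open Classical in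
/-- Defining relations `[x_e, x_f] = [y_e, y_f] = [y_e, x_f] - δ_{ef} = 0`. -/
inductive WeylRel (K E : Type*) [Field K] :
    FreeAlgebra K (WeylGen E) → FreeAlgebra K (WeylGen E) → Prop
  | x_x (e f : E) : WeylRel K E (FreeAlgebra.ι K (.x e) * FreeAlgebra.ι K (.x f))
      (FreeAlgebra.ι K (.x f) * FreeAlgebra.ι K (.x e))
  | y_y (e f : E) : WeylRel K E (FreeAlgebra.ι K (.y e) * FreeAlgebra.ι K (.y f))
      (FreeAlgebra.ι K (.y f) * FreeAlgebra.ι K (.y e))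
  | y_x (e f : E) : WeylRel K E (FreeAlgebra.ι K (.y e) * FreeAlgebra.ι K (.x f))
      (FreeAlgebra.ι K (.x f) * FreeAlgebra.ι K (.y e) + if e = f then 1 else 0)

/-- The Weyl algebra `A_E(K)`. -/
abbrev WeylAlgebra (K E : Type*) [Field K] : Type _ := RingQuot (WeylRel K E)

namespace WeylAlgebra

variable (K : Type*) {E : Type*} [Field K]

/-- The generator `x_e`. -/
def x (e : E) : WeylAlgebra K E := RingQuot.mkAlgHom K (WeylRel K E) (FreeAlgebra.ι K (.x e))

/-- The generator `y_e`. -/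
def y (e : E) : WeylAlgebra K E := RingQuot.mkAlgHom K (WeylRel K E) (FreeAlgebra.ι K (.y e))

/-- `z_e^{(p)}`, which is `x_e ^ p` for `p ≥ 0` and `y_e ^ (-p)` for `p < 0`. -/
def zPow (e : E) (p : ℤ) : WeylAlgebra K E :=
  if 0 ≤ p then x K e ^ p.toNat else y K e ^ (-p).toNat

theorem zPow_commute {e f : E} (h : e ≠ f) (p q : ℤ) : Commute (zPow K e p) (zPow K f q) := by
  have hxx : Commute (x K e) (x K f) := by
    simpa [x, Commute, SemiconjBy] using RingQuot.mkAlgHom_rel K (WeylRel.x_x (K := K) e f)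
  have hyy : Commute (y K e) (y K f) := by
    simpa [y, Commute, SemiconjBy] using RingQuot.mkAlgHom_rel K (WeylRel.y_y (K := K) e f)
  have hyx : Commute (y K e) (x K f) := by
    simpa [x, y, Commute, SemiconjBy, h] using RingQuot.mkAlgHom_rel K (WeylRel.y_x (K := K) e f)
  have hxy : Commute (x K e) (y K f) := by
    have := RingQuot.mkAlgHom_rel K (WeylRel.y_x (K := K) f e)
    simpa [x, y, Commute, SemiconjBy, h.symm, eq_comm] using this
  unfold zPow
  split_ifs
  · exact hxx.pow_pow _ _
  · exact hxy.pow_pow _ _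
  · exact hyx.pow_pow _ _
  · exact hyy.pow_pow _ _

/-- `z^k = ∏_e z_e^{(k_e)}` for `k ∈ ℤ E` (the factors commute). -/
def z (k : E →₀ ℤ) : WeylAlgebra K E :=
  k.support.noncommProd (fun e => zPow K e (k e)) fun _ _ _ _ h => zPow_commute K h _ _

end WeylAlgebra

/-! ### Multiquivers -/

/-- A multiquiver with vertex set `V` and edge set `E`; `none` means that the edge has no source
(respectively no target). -/
structure Multiquiver (V E : Type*) where
  /-- source of an edge, with the outgoing multiplicity -/
  s : E → Option (V × ℕ+)
  /-- target of an edge, with the incoming multiplicity -/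
  t : E → Option (V × ℕ+)
  no_loops : ∀ e u m v n, s e = some (u, m) → t e = some (v, n) → u ≠ v
  finite_s : ∀ v, {e | ∃ n, s e = some (v, n)}.Finite
  finite_t : ∀ v, {e | ∃ n, t e = some (v, n)}.Finite

namespace Multiquiver

variable {V E : Type*} (Γ : Multiquiver V E)

open Classical in
/-- The multiplicity at `v` of a source or target `o`; it is `0` if the vertex is not `v`. -/
def multAt (o : Option (V × ℕ+)) (v : V) : ℕ :=
  match o with
  | none => 0
  | some (w, n) => if w = v then n else 0

theorem multAt_ne_zero {o : Option (V × ℕ+)} {v : V} (h : multAt o v ≠ 0) :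
    ∃ n, o = some (v, n) := by
  rcases o with _ | ⟨w, n⟩
  · simp [multAt] at h
  · by_cases hw : w = v
    · exact ⟨n, by rw [hw]⟩
    · simp [multAt, hw] at h

/-- The vertex `v` is incident to the edge `e`. -/
def Incident (v : V) (e : E) : Prop :=
  (∃ n, Γ.s e = some (v, n)) ∨ ∃ n, Γ.t e = some (v, n)

theorem finite_incident (v : V) : {e | Γ.Incident v e}.Finite :=
  (Γ.finite_s v).union (Γ.finite_t v)

/-! #### The incidence matrix -/

/-- The entry `γ_{ev}` of the incidence matrix. -/
def entry (e : E) (v : V) : ℤ := (multAt (Γ.t e) v : ℤ) - multAt (Γ.s e) v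

theorem entry_support_finite (v : V) : (Function.support fun e => Γ.entry e v).Finite := by
  refine (Γ.finite_incident v).subset fun e he => ?_
  by_contra h
  have h₁ : multAt (Γ.s e) v = 0 := by
    by_contra h'
    exact h (Or.inl (multAt_ne_zero h'))
  have h₂ : multAt (Γ.t e) v = 0 := by
    by_contra h'
    exact h (Or.inr (multAt_ne_zero h'))
  exact he (by simp [entry, h₁, h₂])

/-- The column `γ(v) = ∑_e γ_{ev} e ∈ ℤ E`. -/
def column (v : V) : E →₀ ℤ :=
  Finsupp.ofSupportFinite (fun e => Γ.entry e v) (Γ.entry_support_finite v)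

/-- The incidence matrix, as a homomorphism `γ : ℤ V → ℤ E`. -/
def γ : (V →₀ ℤ) →ₗ[ℤ] (E →₀ ℤ) := Finsupp.linearCombination ℤ Γ.column

/-! #### The algebra `A(Γ)` -/

section algebra

variable (K : Type*) [Field K]

/-- The automorphism `σ_v` of `R_E = K[u_e | e ∈ E]`, `σ_v(u_e) = u_e - γ_{ev}`. -/
def σ (v : V) : MvPolynomial E K ≃ₐ[K] MvPolynomial E K :=
  AlgEquiv.ofAlgHom
    (MvPolynomial.aeval fun e => MvPolynomial.X e - MvPolynomial.C (Γ.entry e v : K))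
    (MvPolynomial.aeval fun e => MvPolynomial.X e + MvPolynomial.C (Γ.entry e v : K))
    (by ext e : 1; simp)
    (by ext e : 1; simp)

/-- The polynomial `u_{ev}`: it is `u_e (u_e + 1) ⋯ (u_e + n - 1)` if `t(e) = (v, n)`, and
`(u_e - 1) ⋯ (u_e - n)` if `s(e) = (v, n)`. At most one of the two products is nonempty. -/
def uEdge (e : E) (v : V) : MvPolynomial E K :=
  (∏ i ∈ Finset.range (multAt (Γ.t e) v), (MvPolynomial.X e + MvPolynomial.C (i : K))) *
    ∏ i ∈ Finset.range (multAt (Γ.s e) v), (MvPolynomial.X e - MvPolynomial.C ((i : K) + 1))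

/-- `t_v`, the product of the `u_{ev}` over the edges `e` incident to `v`. -/
def tElt (v : V) : MvPolynomial E K := ∏ e ∈ (Γ.finite_incident v).toFinset, Γ.uEdge K e v

theorem X_add_C_ne_zero (e : E) (c : K) :
    (MvPolynomial.X e + MvPolynomial.C c : MvPolynomial E K) ≠ 0 := by
  intro h
  have := congrArg (MvPolynomial.eval fun _ => 1 - c) h
  simp at this

theorem tElt_ne_zero (v : V) : Γ.tElt K v ≠ 0 := by
  refine Finset.prod_ne_zero_iff.2 fun e _ => mul_ne_zero ?_ ?_
  · exact Finset.prod_ne_zero_iff.2 fun i _ => X_add_C_ne_zero K e _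
  · refine Finset.prod_ne_zero_iff.2 fun i _ => ?_
    rw [sub_eq_add_neg, ← map_neg]
    exact X_add_C_ne_zero K e _

/-- The twisted generalized Weyl datum `(R_E, σ^Γ, t^Γ)`. -/
def datum : TGWDatum K (MvPolynomial E K) V where
  σ := Γ.σ K
  t := Γ.tElt K
  σ_comm v w r := by
    have h : (Γ.σ K v).toAlgHom.comp (Γ.σ K w).toAlgHom =
        (Γ.σ K w).toAlgHom.comp (Γ.σ K v).toAlgHom := by
      ext e : 1
      simp [σ]
      ring
    exact DFunLike.congr_fun h r
  t_ne_zero := Γ.tElt_ne_zero K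
  t_central _ _ := mul_comm _ _

/-- The algebra `A(Γ)`, the twisted generalized Weyl algebra with `μ_{ij} = 1` for all `i, j`. -/
abbrev Alg : Type _ := (Γ.datum K).TGWAlgebra 1

/-- The generator `X_v` of `A(Γ)`. -/
def X (v : V) : Γ.Alg K := TGWDatum.TGWAlgebra.gen (Γ.datum K) 1 (.X v)

/-- The generator `Y_v` of `A(Γ)`. -/
def Y (v : V) : Γ.Alg K := TGWDatum.TGWAlgebra.gen (Γ.datum K) 1 (.Y v)

/-- The canonical homomorphism `ρ : R_E → A(Γ)`. -/
def ρ : MvPolynomial E K →ₐ[K] Γ.Alg K := TGWDatum.TGWAlgebra.ρ (Γ.datum K) 1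

/-- `φ` is the canonical representation `A(Γ) → A_E(K)` by differential operators: the
homomorphism determined by its values on the generators. -/
structure IsCanonicalRep {K : Type*} [Field K] (φ : Γ.Alg K →ₐ[K] WeylAlgebra K E) : Prop where
  map_X : ∀ v, φ (Γ.X K v) = WeylAlgebra.z K (Γ.γ (Finsupp.single v 1))
  map_Y : ∀ v, φ (Γ.Y K v) = WeylAlgebra.z K (-Γ.γ (Finsupp.single v 1))
  map_u : ∀ e, φ (Γ.ρ K (MvPolynomial.X e)) = WeylAlgebra.y K e * WeylAlgebra.x K e

end algebra

/-! #### Subgraphs, cycles, components -/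

open Classical in
/-- Forget a source or target that is not in `V'`. -/
def restrictEnd (V' : Set V) : Option (V × ℕ+) → Option (V' × ℕ+)
  | none => none
  | some (v, n) => if h : v ∈ V' then some (⟨v, h⟩, n) else none

theorem restrictEnd_eq_some {V' : Set V} {o : Option (V × ℕ+)} {v : V'} {n : ℕ+}
    (h : restrictEnd V' o = some (v, n)) : o = some (v.1, n) := by
  rcases o with _ | ⟨w, m⟩
  · simp [restrictEnd] at h
  · by_cases hw : w ∈ V'
    · simp only [restrictEnd, hw, dite_true, Option.some.injEq, Prod.mk.injEq] at h
      rw [← h.1, ← h.2]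
    · simp [restrictEnd, hw] at h

/-- The subgraph of `Γ` with vertex set `V'` and edge set `E'`. -/
def subgraph (V' : Set V) (E' : Set E) : Multiquiver V' E' where
  s e := restrictEnd V' (Γ.s e)
  t e := restrictEnd V' (Γ.t e)
  no_loops e u m v n hs ht h := Γ.no_loops e u m v n (restrictEnd_eq_some hs)
    (restrictEnd_eq_some ht) (congrArg Subtype.val h)
  finite_s v := Set.Finite.of_finite_image ((Γ.finite_s v).subset (by
    rintro _ ⟨e, ⟨n, hn⟩, rfl⟩
    exact ⟨n, restrictEnd_eq_some hn⟩)) Subtype.val_injective.injOn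
  finite_t v := Set.Finite.of_finite_image ((Γ.finite_t v).subset (by
    rintro _ ⟨e, ⟨n, hn⟩, rfl⟩
    exact ⟨n, restrictEnd_eq_some hn⟩)) Subtype.val_injective.injOn

/-- The enumerations `v`, `e` exhibit `Γ` as a directed cycle with outgoing multiplicities `a` and
incoming multiplicities `b` (indices are cyclic). -/
def IsDirectedCycleVia {n : ℕ} (v : Fin n ≃ V) (e : Fin n ≃ E) (a b : Fin n → ℕ+) : Prop :=
  ∀ i, Γ.s (e i) = some (v i, a i) ∧ Γ.t (e i) = some (v (finRotate n i), b i)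

/-- `Γ` is a directed cycle. -/
def IsDirectedCycle : Prop :=
  ∃ (n : ℕ) (v : Fin n ≃ V) (e : Fin n ≃ E) (a b : Fin n → ℕ+),
    0 < n ∧ Γ.IsDirectedCycleVia v e a b

/-- `Γ` is a directed cycle in which the product of the outgoing multiplicities equals the product
of the incoming multiplicities. -/
def IsBalancedDirectedCycle : Prop :=
  ∃ (n : ℕ) (v : Fin n ≃ V) (e : Fin n ≃ E) (a b : Fin n → ℕ+),
    0 < n ∧ Γ.IsDirectedCycleVia v e a b ∧ ∏ i, a i = ∏ i, b i

/-- Two multiquivers are sign-equivalent if they become isomorphic after changing the direction of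
some edges. -/
def SignEquivalent {V₁ E₁ V₂ E₂ : Type*} (Γ₁ : Multiquiver V₁ E₁) (Γ₂ : Multiquiver V₂ E₂) : Prop :=
  ∃ (f : V₁ ≃ V₂) (g : E₁ ≃ E₂), ∀ e,
    (Γ₂.s (g e) = (Γ₁.s e).map (Prod.map f id) ∧ Γ₂.t (g e) = (Γ₁.t e).map (Prod.map f id)) ∨
    (Γ₂.s (g e) = (Γ₁.t e).map (Prod.map f id) ∧ Γ₂.t (g e) = (Γ₁.s e).map (Prod.map f id))

/-- `Γ` is a not necessarily directed cycle: it is sign-equivalent to a directed cycle (which may be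
taken to have the same vertex and edge sets). -/
def IsNNDCycle : Prop := ∃ Γ' : Multiquiver V E, Γ'.IsDirectedCycle ∧ SignEquivalent Γ Γ'

/-- `Γ` is a balanced not necessarily directed cycle: it is sign-equivalent to a balanced directed
cycle. -/
def IsBalancedNNDCycle : Prop :=
  ∃ Γ' : Multiquiver V E, Γ'.IsBalancedDirectedCycle ∧ SignEquivalent Γ Γ'

/-- A leaf is an edge without source or without target (or both). -/
def IsLeaf (e : E) : Prop := Γ.s e = none ∨ Γ.t e = none

/-- The graph on vertices and edges of `Γ` whose adjacency is incidence. Its connected components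
are the connected components of `Γ`, described by their vertices and edges. -/
def incidenceGraph : SimpleGraph (V ⊕ E) where
  Adj
    | .inl v, .inr e => Γ.Incident v e
    | .inr e, .inl v => Γ.Incident v e
    | _, _ => False
  symm := ⟨by rintro (v | e) (w | f) h <;> exact h⟩
  loopless := ⟨by rintro (v | e) h <;> exact h⟩

/-- A connected component of `Γ`; an edge without source and target is a component by itself. -/
abbrev Component : Type _ := Γ.incidenceGraph.ConnectedComponent

/-- The connected component `C`, as a subgraph of `Γ`. -/
def componentSubgraph (C : Γ.Component) :
    Multiquiver {v : V | Γ.incidenceGraph.connectedComponentMk (.inl v) = C}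
      {e : E | Γ.incidenceGraph.connectedComponentMk (.inr e) = C} :=
  Γ.subgraph _ _

/-- `Γ` has finitely many vertices, no leaves, and every not necessarily directed cycle in `Γ` is
balanced. -/
def InEquilibrium : Prop :=
  Finite V ∧ (∀ e, ¬Γ.IsLeaf e) ∧
    ∀ (V' : Set V) (E' : Set E), (Γ.subgraph V' E').IsNNDCycle →
      (Γ.subgraph V' E').IsBalancedNNDCycle

end Multiquiver

end

/-!
The operators `z^(γ v)`, `z^(-γ v)` and `y_e x_e` satisfy the defining relations of `𝒞`, and the
`z^k` are regular elements of the Weyl algebra. Recording degrees therefore embeds `A(Γ)` into the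
group ring `A_E(K)[ℤV]`, and `φ_Γ` is this embedding followed by forgetting the degree. It maps the
component of degree `d` into the component of degree `γ d` of the Weyl algebra. Acting on `R_E`,
`z^k` is a difference operator with shift `k`; in characteristic zero distinct shifts are linearly
independent over `R_E`. So `φ_Γ` is injective if and only if distinct degrees stay distinct under
`γ`, and since `z^k` commutes with `R_E` only for `k = 0`, the centralizer of `R_E` in `A(Γ)` is
the part of the degrees `d` with `γ d = 0`.

An element of the kernel of `γ` is a finitely supported integer function `k` on the vertices with
`a k(u) = b k(v)` along every edge with ends `(u, a)` and `(v, b)`, and with `k(v) = 0` at every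
leaf. Its value at one vertex of a component determines it on the component, and if it is nonzero
there it is nonzero at every vertex of the component. Hence the component is finite and leafless,
and transporting `k` around a cycle shows that the cycle is balanced. Conversely, if all cycles of
a finite leafless component are balanced, transport along walks defines a nonzero rational
solution, of which a multiple is integral.
-/

noncomputable section

section GradedMonoid

variable {K B ι : Type*} [CommSemiring K] [Semiring B] [Algebra K B] [AddMonoid ι]
  (A : ι → Submodule K B) [SetLike.GradedMonoid A]

theorem iSup_mul_iSup_le_of_gradedMonoid : (⨆ i, A i) * ⨆ i, A i ≤ ⨆ i, A i := by
  rw [Submodule.iSup_mul]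
  refine iSup_le fun i => ?_
  rw [Submodule.mul_iSup]
  refine iSup_le fun j => le_trans ?_ (le_iSup A (i + j))
  exact Submodule.mul_le.2 fun a ha b hb => SetLike.mul_mem_graded ha hb

theorem iSup_eq_top_of_freeAlgebra_surjective {G : Type*} {π : FreeAlgebra K G →ₐ[K] B}
    (hπ : Function.Surjective π) (hgen : ∀ g, ∃ i, π (FreeAlgebra.ι K g) ∈ A i) :
    ⨆ i, A i = ⊤ := by
  refine Submodule.eq_top_iff'.2 fun a => ?_
  obtain ⟨a, rfl⟩ := hπ a
  induction a using FreeAlgebra.induction with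
  | grade0 k =>
    rw [AlgHom.commutes, Algebra.algebraMap_eq_smul_one]
    exact Submodule.smul_mem _ _ (Submodule.mem_iSup_of_mem 0 SetLike.GradedOne.one_mem)
  | grade1 g =>
    obtain ⟨i, hi⟩ := hgen g
    exact Submodule.mem_iSup_of_mem i hi
  | add a b ha hb => exact map_add π a b ▸ add_mem ha hb
  | mul a b ha hb =>
    rw [map_mul]
    exact iSup_mul_iSup_le_of_gradedMonoid A (Submodule.mul_mem_mul ha hb)

end GradedMonoid

/-! ### Representations of the twisted generalized Weyl construction -/

namespace TGWDatum

variable {K R I : Type*} [Field K] [Ring R] [Algebra K R]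

/-- A representation of the twisted generalized Weyl construction `C_μ(R, σ, t)` in a `K`-algebra
`B`: a homomorphism `f` on the coefficients and images `x i`, `y i` of the generators `X i`, `Y i`
that satisfy the defining relations. -/
structure IsRep (D : TGWDatum K R I) (μ : I → I → Kˣ) {B : Type*} [Ring B] [Algebra K B]
    (f : R →ₐ[K] B) (x y : I → B) : Prop where
  x_coeff : ∀ i r, x i * f r = f (D.σ i r) * x i
  y_coeff : ∀ i r, y i * f r = f ((D.σ i).symm r) * y i
  y_x : ∀ i, y i * x i = f (D.t i)
  x_y : ∀ i, x i * y i = f (D.σ i (D.t i))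
  x_y_of_ne : ∀ i j, i ≠ j → x i * y j = μ i j • (y j * x i)

/-- The image of a generator under the representation given by `f`, `x` and `y`. -/
def genVal {B : Type*} (f : R → B) (x y : I → B) : TGWGen R I → B
  | .coeff r => f r
  | .X i => x i
  | .Y i => y i

theorem sum_map_single_apply [DecidableEq I] (l : List I) (i : I) :
    (l.map fun j => Finsupp.single j (1 : ℤ)).sum i = l.count i := by
  induction l with
  | nil => simp
  | cons j l ih => simp [ih, List.count_cons, Finsupp.single_apply, add_comm]

namespace IsRep

variable {D : TGWDatum K R I} {μ : I → I → Kˣ} {B : Type*} [Ring B] [Algebra K B]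
  {f : R →ₐ[K] B} {x y : I → B}

theorem y_x_of_ne (h : D.IsRep μ f x y) {i j : I} (hij : i ≠ j) :
    y j * x i = (μ i j)⁻¹ • (x i * y j) :=
  eq_inv_smul_iff.2 (h.x_y_of_ne i j hij).symm

theorem exists_x_mul_prod_y_of_notMem (h : D.IsRep μ f x y) {i : I} {l : List I} (hi : i ∉ l) :
    ∃ k : Kˣ, x i * (l.map y).prod = k • ((l.map y).prod * x i) := by
  induction l with
  | nil => exact ⟨1, by simp⟩
  | cons j l ih =>
    rw [List.mem_cons, not_or] at hi
    obtain ⟨k, hk⟩ := ih hi.2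
    refine ⟨μ i j * k, ?_⟩
    rw [List.map_cons, List.prod_cons, ← mul_assoc, h.x_y_of_ne i j hi.1, smul_mul_assoc,
      mul_assoc, hk, mul_smul_comm, smul_smul, mul_assoc]

theorem exists_x_mul_prod_y_of_mem [DecidableEq I] (h : D.IsRep μ f x y) {i : I} {l : List I}
    (hi : i ∈ l) : ∃ r, x i * (l.map y).prod = f r * ((l.erase i).map y).prod := by
  induction l with
  | nil => simp at hi
  | cons j l ih =>
    rw [List.map_cons, List.prod_cons, ← mul_assoc]
    rcases eq_or_ne i j with rfl | hij
    · exact ⟨D.σ i (D.t i), by rw [h.x_y, List.erase_cons_head]⟩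
    · obtain ⟨r, hr⟩ := ih (List.mem_of_ne_of_mem hij hi)
      refine ⟨(μ i j : K) • (D.σ j).symm r, ?_⟩
      rw [h.x_y_of_ne i j hij, smul_mul_assoc, mul_assoc, hr, ← mul_assoc, h.y_coeff, mul_assoc,
        ← List.prod_cons, ← List.map_cons, ← List.erase_cons_tail (by simpa using hij.symm),
        map_smul, smul_mul_assoc, Units.smul_def]

theorem exists_y_mul_prod_x_of_mem [DecidableEq I] (h : D.IsRep μ f x y) {i : I} {l : List I}
    (hi : i ∈ l) : ∃ r, y i * (l.map x).prod = f r * ((l.erase i).map x).prod := by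
  induction l with
  | nil => simp at hi
  | cons j l ih =>
    rw [List.map_cons, List.prod_cons, ← mul_assoc]
    rcases eq_or_ne i j with rfl | hij
    · exact ⟨D.t i, by rw [h.y_x, List.erase_cons_head]⟩
    · obtain ⟨r, hr⟩ := ih (List.mem_of_ne_of_mem hij hi)
      refine ⟨((μ j i)⁻¹ : Kˣ) • D.σ j r, ?_⟩
      rw [h.y_x_of_ne hij.symm, smul_mul_assoc, mul_assoc, hr, ← mul_assoc, h.x_coeff, mul_assoc,
        ← List.prod_cons, ← List.map_cons, ← List.erase_cons_tail (by simpa using hij.symm),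
        Units.smul_def, Units.smul_def, map_smul, smul_mul_assoc]

theorem exists_prod_x_mul_prod_y (h : D.IsRep μ f x y) {l l' : List I} (hl : l.Disjoint l') :
    ∃ k : Kˣ, (l.map x).prod * (l'.map y).prod = k • ((l'.map y).prod * (l.map x).prod) := by
  induction l with
  | nil => exact ⟨1, by simp⟩
  | cons i l ih =>
    rw [List.disjoint_cons_left] at hl
    obtain ⟨k, hk⟩ := ih hl.2
    obtain ⟨k', hk'⟩ := h.exists_x_mul_prod_y_of_notMem hl.1
    refine ⟨k * k', ?_⟩
    rw [List.map_cons, List.prod_cons, mul_assoc, hk, mul_smul_comm, ← mul_assoc, hk',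
      smul_mul_assoc, smul_smul, mul_assoc]

/-- `b = r Y_{j₁} ⋯ Y_{jₗ} X_{i₁} ⋯ X_{iₖ}` is a normal form of degree `d`: no index occurs among
both the `i`'s and the `j`'s. The degree is expressed without subtraction. -/
def IsNormalMonomial (f : R →ₐ[K] B) (x y : I → B) (d : I →₀ ℤ) (b : B) : Prop :=
  ∃ (r : R) (J L : List I), J.Disjoint L ∧ b = f r * ((J.map y).prod * (L.map x).prod) ∧
    d + (J.map fun i => Finsupp.single i 1).sum = (L.map fun i => Finsupp.single i 1).sum

theorem isNormalMonomial_one : IsNormalMonomial f x y 0 1 :=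
  ⟨1, [], [], by simp, by simp, by simp⟩

theorem IsNormalMonomial.coeff_mul {d : I →₀ ℤ} {b : B} (hb : IsNormalMonomial f x y d b)
    (r : R) : IsNormalMonomial f x y d (f r * b) := by
  obtain ⟨s, J, L, hJL, rfl, hd⟩ := hb
  exact ⟨r * s, J, L, hJL, by rw [map_mul, mul_assoc], hd⟩

theorem IsNormalMonomial.x_mul (h : D.IsRep μ f x y) {d : I →₀ ℤ} {b : B}
    (hb : IsNormalMonomial f x y d b) (i : I) :
    IsNormalMonomial f x y (Finsupp.single i 1 + d) (x i * b) := by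
  classical
  obtain ⟨r, J, L, hJL, rfl, hd⟩ := hb
  rw [← mul_assoc, h.x_coeff, mul_assoc, ← mul_assoc (x i)]
  refine .coeff_mul ?_ _
  by_cases hi : i ∈ J
  · obtain ⟨s, hs⟩ := h.exists_x_mul_prod_y_of_mem hi
    refine ⟨s, J.erase i, L, List.disjoint_of_subset_left List.erase_subset hJL, ?_, ?_⟩
    · rw [hs, mul_assoc]
    · rw [← hd, ← List.sum_map_erase _ hi]
      abel
  · obtain ⟨k, hk⟩ := h.exists_x_mul_prod_y_of_notMem hi
    refine ⟨algebraMap K R k, J, i :: L, List.disjoint_cons_right.2 ⟨hi, hJL⟩, ?_, ?_⟩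
    · rw [hk, AlgHom.commutes, ← Algebra.smul_def, smul_mul_assoc, List.map_cons, List.prod_cons,
        mul_assoc, Units.smul_def]
    · rw [List.map_cons, List.sum_cons, ← hd, add_assoc]

theorem IsNormalMonomial.y_mul (h : D.IsRep μ f x y) {d : I →₀ ℤ} {b : B}
    (hb : IsNormalMonomial f x y d b) (i : I) :
    IsNormalMonomial f x y (-Finsupp.single i 1 + d) (y i * b) := by
  classical
  obtain ⟨r, J, L, hJL, rfl, hd⟩ := hb
  rw [← mul_assoc, h.y_coeff, mul_assoc]
  refine .coeff_mul ?_ _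
  by_cases hi : i ∈ L
  · obtain ⟨s, hs⟩ := h.exists_y_mul_prod_x_of_mem hi
    have hJL' : (L.erase i).Disjoint J := List.disjoint_of_subset_left List.erase_subset hJL.symm
    obtain ⟨k, hk⟩ := h.exists_prod_x_mul_prod_y hJL.symm
    obtain ⟨k', hk'⟩ := h.exists_prod_x_mul_prod_y hJL'
    refine ⟨((k⁻¹ * k' : Kˣ) : K) • s, J, L.erase i, hJL'.symm, ?_, ?_⟩
    · rw [eq_inv_smul_iff.2 hk.symm, mul_smul_comm, ← mul_assoc, hs, mul_assoc, hk',
        mul_smul_comm, smul_smul, map_smul, smul_mul_assoc, Units.smul_def]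
    · rw [← List.sum_map_erase _ hi] at hd
      rw [add_assoc, hd, neg_add_cancel_left]
  · refine ⟨1, i :: J, L, List.disjoint_cons_left.2 ⟨hi, hJL⟩, ?_, ?_⟩
    · rw [map_one, one_mul, List.map_cons, List.prod_cons, mul_assoc]
    · rw [← hd, List.map_cons, List.sum_cons]
      abel

theorem isNormalMonomial_word (h : D.IsRep μ f x y) (w : List (TGWGen R I)) :
    IsNormalMonomial f x y (w.map TGWGen.deg).sum (w.map (genVal f x y)).prod := by
  induction w with
  | nil => exact isNormalMonomial_one
  | cons g w ih =>
    simp only [List.map_cons, List.prod_cons, List.sum_cons]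
    cases g with
    | coeff r => exact (zero_add (w.map TGWGen.deg).sum).symm ▸ ih.coeff_mul r
    | X i => exact ih.x_mul h i
    | Y i => exact ih.y_mul h i

theorem IsNormalMonomial.mem_range {b : B} (hb : IsNormalMonomial f x y 0 b) : b ∈ f.range := by
  classical
  obtain ⟨r, J, L, hJL, rfl, hd⟩ := hb
  rw [zero_add] at hd
  have hcount (i : I) : J.count i = L.count i := by
    exact_mod_cast sum_map_single_apply J i ▸ sum_map_single_apply L i ▸ DFunLike.congr_fun hd i
  have hmem (i : I) : i ∈ J ↔ i ∈ L := by
    rw [← List.count_pos_iff, hcount, List.count_pos_iff]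
  have hJ : J = [] := List.eq_nil_iff_forall_not_mem.2 fun i hi => hJL hi ((hmem i).1 hi)
  have hL : L = [] := List.eq_nil_iff_forall_not_mem.2 fun i hi => hJL ((hmem i).2 hi) hi
  exact ⟨r, by simp [hJ, hL]⟩

end IsRep

namespace Construction

variable (D : TGWDatum K R I) (μ : I → I → Kˣ)

/-- The canonical homomorphism from `R` to the twisted generalized Weyl construction. -/
def coeffHom : R →ₐ[K] D.Construction μ :=
  AlgHom.ofLinearMap
    { toFun := fun r => gen D μ (.coeff r)
      map_add' := fun r s => by
        simpa [gen] using RingQuot.mkAlgHom_rel K (Rel.coeff_add (D := D) (μ := μ) r s)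
      map_smul' := fun k r => by
        have hmul := RingQuot.mkAlgHom_rel K (Rel.coeff_mul (D := D) (μ := μ) (algebraMap K R k) r)
        have hmap := RingQuot.mkAlgHom_rel K (Rel.coeff_algebraMap (D := D) (μ := μ) k)
        rw [map_mul, hmap, AlgHom.commutes, ← Algebra.smul_def, ← Algebra.smul_def] at hmul
        exact hmul }
    (by simpa [gen] using RingQuot.mkAlgHom_rel K (Rel.coeff_algebraMap (D := D) (μ := μ) 1))
    (fun r s => by
      simpa [gen] using RingQuot.mkAlgHom_rel K (Rel.coeff_mul (D := D) (μ := μ) r s))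

theorem coeffHom_apply (r : R) : coeffHom D μ r = gen D μ (.coeff r) := rfl

theorem isRep_gen :
    D.IsRep μ (coeffHom D μ) (fun i => gen D μ (.X i)) fun i => gen D μ (.Y i) where
  x_coeff i r := by
    simpa [gen, coeffHom_apply] using RingQuot.mkAlgHom_rel K (Rel.X_coeff (D := D) (μ := μ) i r)
  y_coeff i r := by
    simpa [gen, coeffHom_apply] using RingQuot.mkAlgHom_rel K (Rel.Y_coeff (D := D) (μ := μ) i r)
  y_x i := by
    simpa [gen, coeffHom_apply] using RingQuot.mkAlgHom_rel K (Rel.Y_X (D := D) (μ := μ) i)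
  x_y i := by
    simpa [gen, coeffHom_apply] using RingQuot.mkAlgHom_rel K (Rel.X_Y (D := D) (μ := μ) i)
  x_y_of_ne i j hij := by
    simpa [gen, Units.smul_def] using
      RingQuot.mkAlgHom_rel K (Rel.X_Y_ne (D := D) (μ := μ) i j hij)

theorem genVal_gen (g : TGWGen R I) :
    genVal (coeffHom D μ) (fun i => gen D μ (.X i)) (fun i => gen D μ (.Y i)) g = gen D μ g := by
  cases g <;> rfl

variable {D μ} {B : Type*} [Ring B] [Algebra K B] {f : R →ₐ[K] B} {x y : I → B}

/-- The homomorphism from the twisted generalized Weyl construction given by a representation. -/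
def lift (h : D.IsRep μ f x y) : D.Construction μ →ₐ[K] B :=
  RingQuot.liftAlgHom K ⟨FreeAlgebra.lift K (genVal f x y), by
    intro a b hab
    induction hab with
    | coeff_add r s => simp [genVal]
    | coeff_mul r s => simp [genVal]
    | coeff_algebraMap k => simp [genVal]
    | X_coeff i r => simpa [genVal] using h.x_coeff i r
    | Y_coeff i r => simpa [genVal] using h.y_coeff i r
    | Y_X i => simpa [genVal] using h.y_x i
    | X_Y i => simpa [genVal] using h.x_y i
    | X_Y_ne i j hij => simpa [genVal, Units.smul_def] using h.x_y_of_ne i j hij⟩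

@[simp]
theorem lift_gen (h : D.IsRep μ f x y) (g : TGWGen R I) :
    lift h (gen D μ g) = genVal f x y g := by
  simp [lift, gen]

@[simp]
theorem lift_coeffHom (h : D.IsRep μ f x y) (r : R) : lift h (coeffHom D μ r) = f r :=
  lift_gen h (.coeff r)

theorem hom_ext {φ ψ : D.Construction μ →ₐ[K] B}
    (h : ∀ g, φ (gen D μ g) = ψ (gen D μ g)) : φ = ψ :=
  RingQuot.ringQuot_ext' K _ _ (FreeAlgebra.hom_ext (funext h))

/-! ### Homogeneous components -/

variable (D μ)

theorem word_mem_component (w : List (TGWGen R I)) :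
    (w.map (gen D μ)).prod ∈ component D μ (w.map TGWGen.deg).sum :=
  Submodule.subset_span ⟨w, rfl, rfl⟩

instance component_gradedMonoid : SetLike.GradedMonoid (component D μ) where
  one_mem := Submodule.subset_span ⟨[], by simp, by simp⟩
  mul_mem c d a b ha hb := by
    suffices component D μ c * component D μ d ≤ component D μ (c + d) from
      this (Submodule.mul_mem_mul ha hb)
    rw [component, component, Submodule.span_mul_span]
    refine Submodule.span_mono ?_
    rintro _ ⟨_, ⟨w, rfl, rfl⟩, _, ⟨w', rfl, rfl⟩, rfl⟩
    exact ⟨w ++ w', by simp, by simp⟩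

theorem iSup_component : ⨆ d, component D μ d = ⊤ :=
  iSup_eq_top_of_freeAlgebra_surjective _ (RingQuot.mkAlgHom_surjective K (D.Rel μ))
    fun g => ⟨g.deg, by simpa [gen] using word_mem_component D μ [g]⟩

theorem component_zero_le_range_coeffHom :
    component D μ 0 ≤ LinearMap.range (coeffHom D μ).toLinearMap := by
  refine Submodule.span_le.2 ?_
  rintro _ ⟨w, hw, rfl⟩
  have hnormal := (isRep_gen D μ).isNormalMonomial_word w
  rw [hw, funext (genVal_gen D μ)] at hnormal
  exact hnormal.mem_range

end Construction

theorem exists_word_of_deg {R I : Type*} (d : I →₀ ℤ) :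
    ∃ w : List (TGWGen R I), (w.map TGWGen.deg).sum = d ∧ ∀ g ∈ w, ∃ i, g = .X i ∨ g = .Y i := by
  induction d using Finsupp.induction_linear with
  | zero => exact ⟨[], by simp, by simp⟩
  | add c d hc hd =>
    obtain ⟨w, rfl, hw⟩ := hc
    obtain ⟨w', rfl, hw'⟩ := hd
    exact ⟨w ++ w', by simp, List.forall_mem_append.2 ⟨hw, hw'⟩⟩
  | single i n =>
    obtain ⟨n, rfl | rfl⟩ := n.eq_nat_or_neg
    · exact ⟨List.replicate n (.X i), by simp [TGWGen.deg],
        fun g hg => ⟨i, .inl (List.eq_of_mem_replicate hg)⟩⟩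
    · exact ⟨List.replicate n (.Y i), by simp [TGWGen.deg],
        fun g hg => ⟨i, .inr (List.eq_of_mem_replicate hg)⟩⟩

/-! ### Regular representations and the radical -/

namespace IsRep

open Construction

variable {D : TGWDatum K R I} {μ : I → I → Kˣ} {B : Type*} [Ring B] [Algebra K B]
  {f : R →ₐ[K] B} {x y : I → B}

theorem graded (h : D.IsRep μ f x y) :
    D.IsRep μ ((AddMonoidAlgebra.singleZeroAlgHom : B →ₐ[K] AddMonoidAlgebra B (I →₀ ℤ)).comp f)
      (fun i => AddMonoidAlgebra.single (Finsupp.single i 1) (x i))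
      (fun i => AddMonoidAlgebra.single (-Finsupp.single i 1) (y i)) where
  x_coeff i r := by simp [AddMonoidAlgebra.single_mul_single, h.x_coeff]
  y_coeff i r := by simp [AddMonoidAlgebra.single_mul_single, h.y_coeff]
  y_x i := by simp [AddMonoidAlgebra.single_mul_single, h.y_x]
  x_y i := by simp [AddMonoidAlgebra.single_mul_single, h.x_y]
  x_y_of_ne i j hij := by
    simp [AddMonoidAlgebra.single_mul_single, h.x_y_of_ne i j hij, add_comm, Units.smul_def]

theorem lift_graded_gen (h : D.IsRep μ f x y) (g : TGWGen R I) :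
    lift h.graded (gen D μ g) = AddMonoidAlgebra.single g.deg (lift h (gen D μ g)) := by
  cases g <;> simp [genVal, TGWGen.deg]

theorem lift_graded_of_mem (h : D.IsRep μ f x y) {d : I →₀ ℤ} {a : D.Construction μ}
    (ha : a ∈ component D μ d) :
    lift h.graded a = AddMonoidAlgebra.single d (lift h a) := by
  induction ha using Submodule.span_induction with
  | zero => simp
  | add a b _ _ ha hb => rw [map_add, map_add, ha, hb, AddMonoidAlgebra.single_add]
  | smul k a _ ha => rw [map_smul, map_smul, ha, AddMonoidAlgebra.smul_single]
  | mem a ha =>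
    obtain ⟨w, rfl, rfl⟩ := ha
    induction w with
    | nil => simp [AddMonoidAlgebra.one_def]
    | cons g w ih =>
      simp only [List.map_cons, List.prod_cons, List.sum_cons, map_mul] at ih ⊢
      rw [ih, lift_graded_gen, AddMonoidAlgebra.single_mul_single]

theorem lift_mem_graded {ι : Type*} [AddMonoid ι] {A : ι → Submodule K B} [SetLike.GradedMonoid A]
    (h : D.IsRep μ f x y) (φ : (I →₀ ℤ) →+ ι) (hf : ∀ r, f r ∈ A 0)
    (hx : ∀ i, x i ∈ A (φ (Finsupp.single i 1))) (hy : ∀ i, y i ∈ A (φ (-Finsupp.single i 1)))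
    {d : I →₀ ℤ} {a : D.Construction μ} (ha : a ∈ component D μ d) : lift h a ∈ A (φ d) := by
  suffices component D μ d ≤ (A (φ d)).comap (lift h).toLinearMap from this ha
  refine Submodule.span_le.2 ?_
  rintro _ ⟨w, rfl, rfl⟩
  change lift h (w.map (gen D μ)).prod ∈ A (φ (w.map TGWGen.deg).sum)
  rw [map_list_prod, map_list_sum, List.map_map, List.map_map]
  refine SetLike.list_prod_map_mem_graded w _ _ fun g _ => ?_
  cases g with
  | coeff r => simpa [genVal, TGWGen.deg] using hf r
  | X i => simpa [genVal, TGWGen.deg] using hx i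
  | Y i => simpa [genVal, TGWGen.deg] using hy i

/-- A representation is regular if it is faithful on `R` and the generators `X i`, `Y i` act by
left regular elements. The kernel of the graded homomorphism that such a representation induces is
the radical ideal. -/
structure Regular (h : D.IsRep μ f x y) : Prop where
  injective : Function.Injective f
  isLeftRegular_x : ∀ i, IsLeftRegular (x i)
  isLeftRegular_y : ∀ i, IsLeftRegular (y i)

variable {h : D.IsRep μ f x y}

theorem Regular.exists_mem_component (hr : h.Regular) (d : I →₀ ℤ) :
    ∃ a ∈ component D μ d, IsLeftRegular (lift h a) := by
  obtain ⟨w, rfl, hw⟩ := exists_word_of_deg (R := R) d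
  refine ⟨_, word_mem_component D μ w, ?_⟩
  induction w with
  | nil => simpa using isRegular_one.left
  | cons g w ih =>
    rw [List.forall_mem_cons] at hw
    rw [List.map_cons, List.prod_cons, map_mul]
    refine IsLeftRegular.mul ?_ (ih hw.2)
    obtain ⟨i, rfl | rfl⟩ := hw.1
    · simpa [genVal] using hr.isLeftRegular_x i
    · simpa [genVal] using hr.isLeftRegular_y i

-- Multiplying by a regular element of the opposite degree moves a homogeneous element of such an
-- ideal into degree zero, where it vanishes.
theorem Regular.le_ker_lift_graded (hr : h.Regular) {J : Ideal (D.Construction μ)}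
    (hgraded : D.IsGradedIdeal μ J) (hzero : ∀ a ∈ J, a ∈ component D μ 0 → a = 0) :
    J ≤ RingHom.ker (lift h.graded) := by
  intro a ha
  suffices Submodule.span K {b | b ∈ J ∧ ∃ d, b ∈ component D μ d} ≤
    LinearMap.ker (lift h.graded).toLinearMap from this (hgraded a ha)
  refine Submodule.span_le.2 ?_
  rintro b ⟨hb, d, hd⟩
  obtain ⟨c, hc, hreg⟩ := hr.exists_mem_component (-d)
  have hcb : c * b = 0 := hzero _ (J.mul_mem_left c hb)
    (by simpa using SetLike.mul_mem_graded hc hd)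
  have hb0 : lift h b = 0 := hreg (by simpa using congrArg (lift h) hcb)
  simp [h.lift_graded_of_mem hd, hb0]

theorem coeff_lift_graded_sum (h : D.IsRep μ f x y) {a : (I →₀ ℤ) →₀ D.Construction μ}
    (ha : ∀ d, a d ∈ component D μ d) (d : I →₀ ℤ) :
    (lift h.graded (a.sum fun _ b => b)).coeff d = lift h (a d) := by
  classical
  rw [Finsupp.sum, map_sum, Finset.sum_congr rfl fun c _ => h.lift_graded_of_mem (ha c)]
  simp +contextual [AddMonoidAlgebra.coeff_sum, Finsupp.single_apply]

theorem isGradedIdeal_ker_lift_graded (h : D.IsRep μ f x y) :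
    D.IsGradedIdeal μ (RingHom.ker (lift h.graded)) := by
  intro a ha
  obtain ⟨b, hb, rfl⟩ := (Submodule.mem_iSup_iff_exists_finsupp _ a).1
    (iSup_component D μ ▸ Submodule.mem_top)
  refine Submodule.sum_mem _ fun d _ => Submodule.subset_span ⟨?_, d, hb d⟩
  have hbd : lift h (b d) = 0 := by
    rw [← h.coeff_lift_graded_sum hb d, RingHom.mem_ker.1 ha]
    rfl
  simp [RingHom.mem_ker, h.lift_graded_of_mem (hb d), hbd]

theorem Regular.eq_zero_of_lift_graded_eq_zero (hr : h.Regular) {a : D.Construction μ}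
    (ha : lift h.graded a = 0) (hzero : a ∈ component D μ 0) : a = 0 := by
  obtain ⟨r, rfl⟩ := component_zero_le_range_coeffHom D μ hzero
  have hfr : f r = 0 := by
    rw [h.lift_graded_of_mem hzero, AddMonoidAlgebra.single_eq_zero] at ha
    simpa using ha
  rw [(map_eq_zero_iff f hr.injective).1 hfr, map_zero]

theorem Regular.radicalIdeal_eq (hr : h.Regular) :
    D.radicalIdeal μ = RingHom.ker (lift h.graded) :=
  le_antisymm (sSup_le fun _ hJ => hr.le_ker_lift_graded hJ.2.1 hJ.2.2)
    (le_sSup ⟨inferInstance, h.isGradedIdeal_ker_lift_graded,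
      fun _ ha hzero => hr.eq_zero_of_lift_graded_eq_zero ha hzero⟩)

/-- The homomorphism from the twisted generalized Weyl algebra to the group ring `B[ℤ I]` that is
given by a regular representation in `B` and records the degrees. -/
def Regular.gradedHom (hr : h.Regular) : D.TGWAlgebra μ →ₐ[K] AddMonoidAlgebra B (I →₀ ℤ) :=
  Ideal.Quotient.liftₐ _ (lift h.graded) fun a ha => by
    rw [hr.radicalIdeal_eq] at ha
    exact ha

theorem Regular.gradedHom_injective (hr : h.Regular) : Function.Injective hr.gradedHom := by
  rw [injective_iff_map_eq_zero]
  intro a ha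
  obtain ⟨a, rfl⟩ := Ideal.Quotient.mk_surjective a
  rw [Ideal.Quotient.eq_zero_iff_mem, hr.radicalIdeal_eq]
  exact ha

theorem Regular.gradedHom_ρ (hr : h.Regular) (r : R) :
    hr.gradedHom (TGWAlgebra.ρ D μ r) = AddMonoidAlgebra.single 0 (f r) :=
  lift_gen h.graded (.coeff r)

theorem Regular.exists_lift_eq_coeff_gradedHom (hr : h.Regular) (a : D.TGWAlgebra μ)
    (d : I →₀ ℤ) : ∃ b ∈ component D μ d, lift h b = (hr.gradedHom a).coeff d := by
  obtain ⟨a, rfl⟩ := Ideal.Quotient.mk_surjective a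
  obtain ⟨b, hb, rfl⟩ := (Submodule.mem_iSup_iff_exists_finsupp _ a).1
    (iSup_component D μ ▸ Submodule.mem_top)
  exact ⟨b d, hb d, (h.coeff_lift_graded_sum hb d).symm⟩

/-- The homomorphism `B[ℤ I] → B` that forgets the degrees. -/
def forgetDegree (K I B : Type*) [Field K] [Ring B] [Algebra K B] :
    AddMonoidAlgebra B (I →₀ ℤ) →ₐ[K] B :=
  AddMonoidAlgebra.liftNCAlgHom (AlgHom.id K B) 1 fun _ _ => Commute.one_right _

@[simp]
theorem forgetDegree_single (d : I →₀ ℤ) (b : B) :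
    forgetDegree K I B (AddMonoidAlgebra.single d b) = b := by
  simp [forgetDegree]

theorem forgetDegree_eq_sum (p : AddMonoidAlgebra B (I →₀ ℤ)) :
    forgetDegree K I B p = p.coeff.sum fun _ b => b := by
  conv_lhs => rw [← AddMonoidAlgebra.sum_coeff_single p]
  simp [Finsupp.sum]

/-- The homomorphism from the twisted generalized Weyl algebra given by a regular
representation. -/
def Regular.hom (hr : h.Regular) : D.TGWAlgebra μ →ₐ[K] B :=
  (forgetDegree K I B).comp hr.gradedHom

theorem Regular.hom_mk (hr : h.Regular) (a : D.Construction μ) :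
    hr.hom (Ideal.Quotient.mk _ a) = lift h a := by
  have hcomp : (forgetDegree K I B).comp (lift h.graded) = lift h :=
    hom_ext fun g => by rw [AlgHom.comp_apply, lift_graded_gen, forgetDegree_single]
  exact DFunLike.congr_fun hcomp a

theorem Regular.hom_gen (hr : h.Regular) (g : TGWGen R I) :
    hr.hom (TGWAlgebra.gen D μ g) = genVal f x y g :=
  (hr.hom_mk _).trans (lift_gen h g)

end IsRep

theorem TGWAlgebra.hom_ext {D : TGWDatum K R I} {μ : I → I → Kˣ} {B : Type*} [Ring B] [Algebra K B]
    {φ ψ : D.TGWAlgebra μ →ₐ[K] B}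
    (h : ∀ g, φ (TGWAlgebra.gen D μ g) = ψ (TGWAlgebra.gen D μ g)) : φ = ψ := by
  ext a
  obtain ⟨a, rfl⟩ := Ideal.Quotient.mk_surjective a
  have hcomp : φ.comp (Ideal.Quotient.mkₐ K _) = ψ.comp (Ideal.Quotient.mkₐ K _) :=
    Construction.hom_ext h
  exact DFunLike.congr_fun hcomp a

end TGWDatum

/-! ### The Weyl algebra as an algebra of difference operators -/

namespace WeylAlgebra

open MvPolynomial (X C aeval)

section Shift

variable {R E : Type*} [CommRing R]

/-- The translation `u_e ↦ u_e - k_e` of a polynomial ring by an integer vector `k`. -/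
def shift (k : E →₀ ℤ) : MvPolynomial E R →ₐ[R] MvPolynomial E R :=
  aeval fun e => X e - C (k e : R)

@[simp]
theorem shift_X (k : E →₀ ℤ) (e : E) : shift k (X e : MvPolynomial E R) = X e - C (k e : R) := by
  simp [shift]

theorem shift_shift (k l : E →₀ ℤ) (f : MvPolynomial E R) :
    shift k (shift l f) = shift (k + l) f := by
  have h : (shift k).comp (shift l) = (shift (k + l) : MvPolynomial E R →ₐ[R] _) := by
    ext e : 1
    simp [sub_sub]
  exact DFunLike.congr_fun h f

@[simp]
theorem shift_zero (f : MvPolynomial E R) : shift 0 f = f := by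
  have h : shift 0 = AlgHom.id R (MvPolynomial E R) := by
    ext e : 1
    simp
  exact DFunLike.congr_fun h f

theorem shift_injective (k : E →₀ ℤ) :
    Function.Injective (shift k : MvPolynomial E R →ₐ[R] MvPolynomial E R) :=
  Function.LeftInverse.injective (g := shift (-k)) fun f => by simp [shift_shift]

theorem linearIndependent_shift [IsDomain R] [CharZero R] :
    LinearIndependent (MvPolynomial E R)
      fun (k : E →₀ ℤ) (f : MvPolynomial E R) => shift k f := by
  refine (linearIndependent_monoidHom (MvPolynomial E R) (MvPolynomial E R)).comp
    (fun k : E →₀ ℤ => ((shift k : MvPolynomial E R →ₐ[R] MvPolynomial E R) :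
      MvPolynomial E R →* MvPolynomial E R)) fun k l hkl => ?_
  ext e
  simpa using DFunLike.congr_fun hkl (X e)

end Shift

section ZCoeff

variable (K : Type*) {E : Type*} [Field K]

/-- The rising factorial `u_e (u_e + 1) ⋯ (u_e + n - 1)`. -/
def rising (e : E) (n : ℕ) : MvPolynomial E K := ∏ i ∈ Finset.range n, (X e + C (i : K))

@[simp]
theorem rising_zero (e : E) : rising K e 0 = 1 := by simp [rising]

theorem rising_succ (e : E) (n : ℕ) : rising K e (n + 1) = rising K e n * (X e + C (n : K)) :=
  Finset.prod_range_succ ..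

theorem rising_ne_zero (e : E) (n : ℕ) : rising K e n ≠ 0 :=
  Finset.prod_ne_zero_iff.2 fun _ _ => Multiquiver.X_add_C_ne_zero K e _

theorem shift_rising (k : E →₀ ℤ) (e : E) (n : ℕ) :
    shift k (rising K e n) = ∏ i ∈ Finset.range n, (X e - C (k e : K) + C (i : K)) := by
  simp [rising, map_prod]

theorem shift_rising_of_eq_zero {k : E →₀ ℤ} {e : E} (hk : k e = 0) (n : ℕ) :
    shift k (rising K e n) = rising K e n := by
  simp [rising, hk]

/-- The polynomial factor of the difference operator `f ↦ zCoeff K k * shift k f` by which `z^k`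
acts on `K[u_e | e ∈ E]`; only the negative entries of `k` contribute. -/
def zCoeff (k : E →₀ ℤ) : MvPolynomial E K := k.prod fun e p => rising K e (-p).toNat

theorem zCoeff_ne_zero (k : E →₀ ℤ) : zCoeff K k ≠ 0 :=
  Finset.prod_ne_zero_iff.2 fun _ _ => rising_ne_zero K _ _

theorem zCoeff_eq_prod {k : E →₀ ℤ} {S : Finset E} (h : k.support ⊆ S) :
    zCoeff K k = ∏ e ∈ S, rising K e (-k e).toNat :=
  Finsupp.prod_of_support_subset k h _ (by simp)

theorem zCoeff_single_add {k : E →₀ ℤ} {e : E} (he : e ∉ k.support) (p : ℤ) :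
    zCoeff K (Finsupp.single e p + k) =
      rising K e (-p).toNat * shift (Finsupp.single e p) (zCoeff K k) := by
  have hdisj : Disjoint (Finsupp.single e p).support k.support :=
    Finset.disjoint_of_subset_left Finsupp.support_single_subset
      (Finset.disjoint_singleton_left.2 he)
  have hshift : shift (Finsupp.single e p) (zCoeff K k) = zCoeff K k := by
    rw [zCoeff, Finsupp.prod, map_prod]
    refine Finset.prod_congr rfl fun f hf => shift_rising_of_eq_zero K ?_ _
    exact Finsupp.single_eq_of_ne fun h => he (h ▸ hf)
  rw [hshift, zCoeff, Finsupp.prod_add_index_of_disjoint hdisj, Finsupp.prod_single_index (by simp),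
    ← zCoeff]

end ZCoeff

variable (K : Type*) {E : Type*} [Field K]

theorem commute_x_x (e f : E) : Commute (x K e) (x K f) := by
  simpa [x, Commute, SemiconjBy] using RingQuot.mkAlgHom_rel K (WeylRel.x_x (K := K) e f)

theorem commute_y_y (e f : E) : Commute (y K e) (y K f) := by
  simpa [y, Commute, SemiconjBy] using RingQuot.mkAlgHom_rel K (WeylRel.y_y (K := K) e f)

theorem commute_y_x {e f : E} (h : e ≠ f) : Commute (y K e) (x K f) := by
  simpa [x, y, Commute, SemiconjBy, h] using RingQuot.mkAlgHom_rel K (WeylRel.y_x (K := K) e f)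

theorem y_mul_x (e : E) : y K e * x K e = x K e * y K e + 1 := by
  simpa [x, y] using RingQuot.mkAlgHom_rel K (WeylRel.y_x (K := K) e e)

theorem commute_x_y_mul_x {e f : E} (h : e ≠ f) : Commute (x K e) (y K f * x K f) :=
  (commute_y_x K h.symm).symm.mul_right (commute_x_x K e f)

theorem commute_y_y_mul_x {e f : E} (h : e ≠ f) : Commute (y K e) (y K f * x K f) :=
  (commute_y_y K e f).mul_right (commute_y_x K h)

theorem commute_y_mul_x (e f : E) : Commute (y K e * x K e) (y K f * x K f) := by
  by_cases h : e = f
  · rw [h]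
  · exact (commute_y_y_mul_x K h).mul_left (commute_x_y_mul_x K h)

variable (E) in
theorem isMulCommutative_adjoin_y_mul_x :
    IsMulCommutative (Algebra.adjoin K (Set.range fun e : E => y K e * x K e)) :=
  Algebra.isMulCommutative_adjoin K (by
    rintro _ ⟨e, rfl⟩ _ ⟨f, rfl⟩
    exact commute_y_mul_x K e f)

open scoped IsMulCommutative in
variable (E) in
/-- The homomorphism `K[u_e | e ∈ E] → A_E(K)`, `u_e ↦ y_e x_e`. As `MvPolynomial.aeval` needs a
commutative target, it is defined through the commutative subalgebra generated by the `y_e x_e`. -/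
def polyHom : MvPolynomial E K →ₐ[K] WeylAlgebra K E :=
  haveI := isMulCommutative_adjoin_y_mul_x K E
  (Algebra.adjoin K (Set.range fun e : E => y K e * x K e)).val.comp
    (aeval (S₁ := Algebra.adjoin K (Set.range fun e : E => y K e * x K e))
      fun e => ⟨y K e * x K e, Algebra.subset_adjoin ⟨e, rfl⟩⟩)

@[simp]
theorem polyHom_X (e : E) : polyHom K E (X e) = y K e * x K e := by
  simp [polyHom]

theorem mul_polyHom_of_forall_X {a : WeylAlgebra K E} {k : E →₀ ℤ}
    (h : ∀ e, a * polyHom K E (X e) = polyHom K E (shift k (X e)) * a) (r : MvPolynomial E K) :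
    a * polyHom K E r = polyHom K E (shift k r) * a := by
  induction r using MvPolynomial.induction_on with
  | C c => simp [Algebra.commutes]
  | add p q hp hq => simp only [map_add, mul_add, add_mul, hp, hq]
  | mul_X p f hp => rw [map_mul, ← mul_assoc, hp, mul_assoc, h, map_mul, map_mul, mul_assoc]

theorem x_mul_polyHom (e : E) (r : MvPolynomial E K) :
    x K e * polyHom K E r = polyHom K E (shift (Finsupp.single e 1) r) * x K e := by
  refine mul_polyHom_of_forall_X K (fun f => ?_) r
  by_cases h : e = f
  · subst h
    simp [y_mul_x, mul_add, mul_assoc]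
  · simpa [Finsupp.single_eq_of_ne (Ne.symm h)] using (commute_x_y_mul_x K h).eq

theorem y_mul_polyHom (e : E) (r : MvPolynomial E K) :
    y K e * polyHom K E r = polyHom K E (shift (-Finsupp.single e 1) r) * y K e := by
  refine mul_polyHom_of_forall_X K (fun f => ?_) r
  by_cases h : e = f
  · subst h
    have hshift : polyHom K E (shift (-Finsupp.single e 1) (X e)) = y K e * x K e + 1 := by simp
    rw [hshift, polyHom_X, add_mul, one_mul, mul_assoc, y_mul_x, mul_add, mul_one]
  · simpa [Finsupp.single_eq_of_ne (Ne.symm h)] using (commute_y_y_mul_x K h).eq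

theorem zPow_natCast (e : E) (n : ℕ) : zPow K e n = x K e ^ n := by simp [zPow]

theorem zPow_neg_natCast (e : E) (n : ℕ) : zPow K e (-n) = y K e ^ n := by
  rcases n with _ | n
  · simp [zPow]
  · have h : ¬(0 : ℤ) ≤ -((n + 1 : ℕ) : ℤ) := by lia
    simp only [zPow, h, if_false, neg_neg, Int.toNat_natCast]

@[simp]
theorem zPow_zero (e : E) : zPow K e 0 = 1 := by simp [zPow]

@[simp]
theorem z_zero : z K (0 : E →₀ ℤ) = 1 := by simp [z]

theorem commute_zPow_zPow_of_mul_nonneg (e : E) {p q : ℤ} (h : 0 ≤ p * q) :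
    Commute (zPow K e p) (zPow K e q) := by
  rcases mul_nonneg_iff.1 h with ⟨hp, hq⟩ | ⟨hp, hq⟩
  · lift p to ℕ using hp
    lift q to ℕ using hq
    simpa only [zPow_natCast] using (Commute.refl (x K e)).pow_pow p q
  · obtain ⟨m, rfl⟩ := Int.exists_eq_neg_ofNat hp
    obtain ⟨n, rfl⟩ := Int.exists_eq_neg_ofNat hq
    simpa only [zPow_neg_natCast] using (Commute.refl (y K e)).pow_pow m n

theorem commute_z_z_of_mul_nonneg {k l : E →₀ ℤ} (h : ∀ e, 0 ≤ k e * l e) :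
    Commute (z K k) (z K l) := by
  have hz (e f : E) : Commute (zPow K e (k e)) (zPow K f (l f)) := by
    by_cases hef : e = f
    · exact hef ▸ commute_zPow_zPow_of_mul_nonneg K e (h e)
    · exact zPow_commute K hef _ _
  exact Finset.noncommProd_commute _ _ _ _ fun f _ =>
    (Finset.noncommProd_commute _ _ _ _ fun e _ => (hz e f).symm).symm

theorem z_eq_zPow_mul_z_erase (e : E) (k : E →₀ ℤ) :
    z K k = zPow K e (k e) * z K (k.erase e) := by
  classical
  have herase : z K (k.erase e) = (k.support.erase e).noncommProd (fun f => zPow K f (k f))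
      fun _ _ _ _ h => zPow_commute K h _ _ := by
    refine Finset.noncommProd_congr Finsupp.support_erase (fun f hf => ?_) _
    rw [Finsupp.erase_ne (Finset.ne_of_mem_erase hf)]
  rw [herase]
  by_cases he : e ∈ k.support
  · rw [← Finset.noncommProd_insert_of_notMem _ _ (fun f => zPow K f (k f))
      (fun _ _ _ _ h => zPow_commute K h _ _) (Finset.notMem_erase e _)]
    exact Finset.noncommProd_congr (Finset.insert_erase he).symm (fun _ _ => rfl) _
  · rw [Finsupp.notMem_support_iff.1 he, zPow_zero, one_mul]
    exact Finset.noncommProd_congr (Finset.erase_eq_of_notMem he).symm (fun _ _ => rfl) _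

theorem z_add_single (e : E) (k : E →₀ ℤ) (p : ℤ) :
    z K (k + Finsupp.single e p) = zPow K e (k e + p) * z K (k.erase e) := by
  rw [z_eq_zPow_mul_z_erase K e]
  simp

theorem z_single_add_of_notMem {e : E} {k : E →₀ ℤ} (he : e ∉ k.support) (p : ℤ) :
    z K (Finsupp.single e p + k) = zPow K e p * z K k := by
  rw [add_comm, z_add_single, Finsupp.erase_of_notMem_support he, Finsupp.notMem_support_iff.1 he,
    zero_add]

theorem exists_x_mul_zPow (e : E) (p : ℤ) :
    ∃ q, x K e * zPow K e p = polyHom K E q * zPow K e (p + 1) := by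
  obtain ⟨n, rfl | rfl⟩ := p.eq_nat_or_neg
  · refine ⟨1, ?_⟩
    rw [map_one, one_mul, zPow_natCast, ← pow_succ', ← zPow_natCast, Nat.cast_succ]
  · rcases n with _ | n
    · exact ⟨1, by simpa using (zPow_natCast K e 1).symm⟩
    · refine ⟨X e - 1, ?_⟩
      have hn : -((n + 1 : ℕ) : ℤ) + 1 = -(n : ℤ) := by lia
      rw [hn, zPow_neg_natCast, zPow_neg_natCast, pow_succ', ← mul_assoc]
      simp [y_mul_x]

theorem exists_y_mul_zPow (e : E) (p : ℤ) :
    ∃ q, y K e * zPow K e p = polyHom K E q * zPow K e (p + -1) := by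
  obtain ⟨n, rfl | rfl⟩ := p.eq_nat_or_neg
  · rcases n with _ | n
    · exact ⟨1, by simpa using (zPow_neg_natCast K e 1).symm⟩
    · refine ⟨X e, ?_⟩
      have hn : ((n + 1 : ℕ) : ℤ) + -1 = n := by lia
      rw [hn, zPow_natCast, zPow_natCast, pow_succ', ← mul_assoc, polyHom_X]
  · refine ⟨1, ?_⟩
    have hn : -(n : ℤ) + -1 = -((n + 1 : ℕ) : ℤ) := by lia
    rw [map_one, one_mul, hn, zPow_neg_natCast, zPow_neg_natCast, pow_succ']

/-- The left `K[u_e | e ∈ E]`-submodule of the Weyl algebra generated by `z^k`, which is its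
homogeneous component of degree `k ∈ ℤE`. -/
def component (k : E →₀ ℤ) : Submodule K (WeylAlgebra K E) :=
  LinearMap.range ((LinearMap.mulRight K (z K k)).comp (polyHom K E).toLinearMap)

theorem mem_component {k : E →₀ ℤ} {a : WeylAlgebra K E} :
    a ∈ component K k ↔ ∃ r, polyHom K E r * z K k = a := by
  simp [component]

theorem x_mul_mem_component (e : E) {k : E →₀ ℤ} {a : WeylAlgebra K E} (ha : a ∈ component K k) :
    x K e * a ∈ component K (k + Finsupp.single e 1) := by
  obtain ⟨r, rfl⟩ := (mem_component K).1 ha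
  obtain ⟨q, hq⟩ := exists_x_mul_zPow K e (k e)
  refine (mem_component K).2 ⟨shift (Finsupp.single e 1) r * q, ?_⟩
  rw [z_add_single, ← mul_assoc (x K e), x_mul_polyHom, z_eq_zPow_mul_z_erase K e k,
    mul_assoc _ (x K e), ← mul_assoc (x K e), hq, map_mul]
  simp only [mul_assoc]

theorem y_mul_mem_component (e : E) {k : E →₀ ℤ} {a : WeylAlgebra K E} (ha : a ∈ component K k) :
    y K e * a ∈ component K (k + Finsupp.single e (-1)) := by
  obtain ⟨r, rfl⟩ := (mem_component K).1 ha
  obtain ⟨q, hq⟩ := exists_y_mul_zPow K e (k e)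
  refine (mem_component K).2 ⟨shift (-Finsupp.single e 1) r * q, ?_⟩
  rw [z_add_single, ← mul_assoc (y K e), y_mul_polyHom, z_eq_zPow_mul_z_erase K e k,
    mul_assoc _ (y K e), ← mul_assoc (y K e), hq, map_mul]
  simp only [mul_assoc]

theorem zPow_mul_mem_component (e : E) (p : ℤ) {k : E →₀ ℤ} {a : WeylAlgebra K E}
    (ha : a ∈ component K k) : zPow K e p * a ∈ component K (Finsupp.single e p + k) := by
  obtain ⟨n, rfl | rfl⟩ := p.eq_nat_or_neg
  · rw [zPow_natCast]
    induction n with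
    | zero => simpa using ha
    | succ n ih =>
      rw [pow_succ', mul_assoc, Nat.cast_succ, Finsupp.single_add, add_right_comm]
      exact x_mul_mem_component K e ih
  · rw [zPow_neg_natCast]
    induction n with
    | zero => simpa using ha
    | succ n ih =>
      rw [pow_succ', mul_assoc, Nat.cast_succ, neg_add, Finsupp.single_add, add_right_comm]
      exact y_mul_mem_component K e ih

theorem z_mul_mem_component (l : E →₀ ℤ) {k : E →₀ ℤ} {a : WeylAlgebra K E}
    (ha : a ∈ component K k) : z K l * a ∈ component K (l + k) := by
  induction l using Finsupp.induction with
  | zero => simpa using ha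
  | single_add e p l he _ ih =>
    rw [z_single_add_of_notMem K he, mul_assoc, add_assoc]
    exact zPow_mul_mem_component K e p ih

theorem polyHom_mul_mem_component (r : MvPolynomial E K) {k : E →₀ ℤ} {a : WeylAlgebra K E}
    (ha : a ∈ component K k) : polyHom K E r * a ∈ component K k := by
  obtain ⟨s, rfl⟩ := (mem_component K).1 ha
  exact (mem_component K).2 ⟨r * s, by rw [map_mul, mul_assoc]⟩

theorem polyHom_mem_component_zero (r : MvPolynomial E K) : polyHom K E r ∈ component K 0 :=
  (mem_component K).2 ⟨r, by simp⟩

theorem z_mem_component (k : E →₀ ℤ) : z K k ∈ component K k :=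
  (mem_component K).2 ⟨1, by simp⟩

instance component_gradedMonoid : SetLike.GradedMonoid (component K (E := E)) where
  one_mem := by simpa using polyHom_mem_component_zero K (E := E) 1
  mul_mem k l a b ha hb := by
    obtain ⟨r, rfl⟩ := (mem_component K).1 ha
    rw [mul_assoc]
    exact polyHom_mul_mem_component K r (z_mul_mem_component K k hb)

variable (E) in
theorem iSup_component : ⨆ k : E →₀ ℤ, component K k = ⊤ := by
  have hone : (1 : WeylAlgebra K E) ∈ component K 0 := SetLike.GradedOne.one_mem
  refine iSup_eq_top_of_freeAlgebra_surjective _ (RingQuot.mkAlgHom_surjective K (WeylRel K E))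
    fun g => ?_
  cases g with
  | x e => exact ⟨_, by simpa [x] using x_mul_mem_component K e hone⟩
  | y e => exact ⟨_, by simpa [y] using y_mul_mem_component K e hone⟩

/-- The action of the generators of the Weyl algebra on `K[u_e | e ∈ E]` by difference operators:
`x_e` acts by `u_e ↦ u_e - 1`, and `y_e` by `u_e ↦ u_e + 1` followed by multiplication by `u_e`,
so that `y_e x_e` acts as multiplication by `u_e`. -/
def diffGen : WeylGen E → Module.End K (MvPolynomial E K)
  | .x e => (shift (Finsupp.single e 1)).toLinearMap
  | .y e => (LinearMap.mulLeft K (X e)).comp (shift (-Finsupp.single e 1)).toLinearMap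

variable (E) in
/-- The representation of the Weyl algebra by difference operators on `K[u_e | e ∈ E]`. It is
faithful in characteristic zero and serves to verify identities between the `z^k`. -/
def diffRep : WeylAlgebra K E →ₐ[K] Module.End K (MvPolynomial E K) :=
  RingQuot.liftAlgHom K ⟨FreeAlgebra.lift K (diffGen K), by
    classical
    intro a b hab
    refine LinearMap.ext fun p => ?_
    induction hab with
    | x_x e f => simp [diffGen, shift_shift, add_comm]
    | y_y e f =>
      by_cases h : e = f
      · rw [h]
      · simp [diffGen, shift_shift, h, Ne.symm h, mul_left_comm, add_comm]
    | y_x e f =>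
      by_cases h : e = f
      · subst h
        simp [diffGen, shift_shift, sub_mul]
      · simp [diffGen, shift_shift, h, add_comm]⟩

@[simp]
theorem diffRep_x (e : E) (f : MvPolynomial E K) :
    diffRep K E (x K e) f = shift (Finsupp.single e 1) f := by
  simp [diffRep, x, diffGen]

@[simp]
theorem diffRep_y (e : E) (f : MvPolynomial E K) :
    diffRep K E (y K e) f = X e * shift (-Finsupp.single e 1) f := by
  simp [diffRep, y, diffGen]

@[simp]
theorem diffRep_polyHom (r f : MvPolynomial E K) : diffRep K E (polyHom K E r) f = r * f := by
  have h : (diffRep K E).comp (polyHom K E) = Algebra.lmul K (MvPolynomial E K) := by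
    ext e : 1
    refine LinearMap.ext fun p => ?_
    simp [shift_shift]
  exact LinearMap.congr_fun (DFunLike.congr_fun h r) f

theorem diffRep_x_pow (e : E) (n : ℕ) (f : MvPolynomial E K) :
    diffRep K E (x K e ^ n) f = shift (Finsupp.single e n) f := by
  induction n generalizing f with
  | zero => simp
  | succ n ih =>
    rw [pow_succ, map_mul, Module.End.mul_apply, diffRep_x, ih, shift_shift, ← Finsupp.single_add,
      Nat.cast_succ]

theorem diffRep_y_pow (e : E) (n : ℕ) (f : MvPolynomial E K) :
    diffRep K E (y K e ^ n) f = rising K e n * shift (Finsupp.single e (-n)) f := by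
  induction n generalizing f with
  | zero => simp
  | succ n ih =>
    have hn : -((n + 1 : ℕ) : ℤ) = -n + -1 := by lia
    rw [pow_succ, map_mul, Module.End.mul_apply, diffRep_y, ih, map_mul, shift_shift,
      ← Finsupp.single_neg, ← Finsupp.single_add, rising_succ, mul_assoc, hn]
    simp

theorem diffRep_zPow (e : E) (p : ℤ) (f : MvPolynomial E K) :
    diffRep K E (zPow K e p) f = rising K e (-p).toNat * shift (Finsupp.single e p) f := by
  obtain ⟨n, rfl | rfl⟩ := p.eq_nat_or_neg
  · rw [zPow_natCast, diffRep_x_pow]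
    simp
  · rw [zPow_neg_natCast, diffRep_y_pow]
    simp

theorem diffRep_z (k : E →₀ ℤ) (f : MvPolynomial E K) :
    diffRep K E (z K k) f = zCoeff K k * shift k f := by
  induction k using Finsupp.induction generalizing f with
  | zero => simp [zCoeff]
  | single_add e p k he _ ih =>
    rw [z_single_add_of_notMem K he, map_mul, Module.End.mul_apply, ih, diffRep_zPow, map_mul,
      shift_shift, ← mul_assoc, zCoeff_single_add K he]

theorem eq_zero_of_diffRep_sum_eq_zero [CharZero K] {S : Finset (E →₀ ℤ)}
    {a : (E →₀ ℤ) → WeylAlgebra K E} (ha : ∀ k ∈ S, a k ∈ component K k)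
    (hsum : diffRep K E (∑ k ∈ S, a k) = 0) : ∀ k ∈ S, a k = 0 := by
  choose! r hr using fun k hk => (mem_component K).1 (ha k hk)
  have hshift : ∑ k ∈ S, (r k * zCoeff K k) •
      (fun f : MvPolynomial E K => (shift k f : MvPolynomial E K)) = 0 := by
    funext f
    rw [← Finset.sum_congr rfl hr] at hsum
    simpa [map_sum, LinearMap.sum_apply, diffRep_z, mul_assoc] using LinearMap.congr_fun hsum f
  intro k hk
  have hk0 := linearIndependent_iff'.1 linearIndependent_shift S _ hshift k hk
  rw [← hr k hk, (mul_eq_zero.1 hk0).resolve_right (zCoeff_ne_zero K k), map_zero, zero_mul]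

variable (E) in
theorem diffRep_injective [CharZero K] : Function.Injective (diffRep K E) := by
  refine (injective_iff_map_eq_zero _).2 fun a ha => ?_
  obtain ⟨b, hb, rfl⟩ := (Submodule.mem_iSup_iff_exists_finsupp _ a).1
    (iSup_component K E ▸ Submodule.mem_top)
  exact Finset.sum_eq_zero (eq_zero_of_diffRep_sum_eq_zero K (fun k _ => hb k) ha)

variable (E) in
theorem polyHom_injective : Function.Injective (polyHom K E) := fun r s h => by
  simpa using LinearMap.congr_fun (congrArg (diffRep K E) h) 1

section CharZero

variable [CharZero K]

theorem isLeftRegular_z (k : E →₀ ℤ) : IsLeftRegular (z K k) := by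
  intro a b hab
  refine diffRep_injective K E (LinearMap.ext fun f => ?_)
  have h := LinearMap.congr_fun (congrArg (diffRep K E) hab) f
  simp only [map_mul, Module.End.mul_apply, diffRep_z] at h
  exact shift_injective k (mul_left_cancel₀ (zCoeff_ne_zero K k) h)

theorem z_mul_polyHom (k : E →₀ ℤ) (r : MvPolynomial E K) :
    z K k * polyHom K E r = polyHom K E (shift k r) * z K k := by
  refine diffRep_injective K E (LinearMap.ext fun f => ?_)
  simp only [map_mul, Module.End.mul_apply, diffRep_z, diffRep_polyHom, mul_left_comm]

theorem z_neg_mul_z (k : E →₀ ℤ) :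
    z K (-k) * z K k = polyHom K E (zCoeff K (-k) * shift (-k) (zCoeff K k)) := by
  refine diffRep_injective K E (LinearMap.ext fun f => ?_)
  simp [diffRep_z, shift_shift]

variable (E) in
theorem iSupIndep_component : iSupIndep (component K (E := E)) :=
  iSupIndep_iff_finsetSum_eq_zero_imp_eq_zero _ |>.2 fun S a ha hsum =>
    eq_zero_of_diffRep_sum_eq_zero K ha (by rw [hsum, map_zero])

theorem eq_zero_of_mem_component_of_commute {k : E →₀ ℤ} {a : WeylAlgebra K E}
    (ha : a ∈ component K k) {e : E} (he : k e ≠ 0) (hcomm : Commute a (polyHom K E (X e))) :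
    a = 0 := by
  obtain ⟨r, rfl⟩ := (mem_component K).1 ha
  have hdiff := LinearMap.congr_fun (congrArg (diffRep K E) hcomm.eq) 1
  simp only [map_mul, Module.End.mul_apply, diffRep_polyHom, diffRep_z, map_one, mul_one,
    shift_X] at hdiff
  have hmul : r * (zCoeff K k * C (k e : K)) = 0 := by linear_combination -hdiff
  have hr : r = 0 := (mul_eq_zero.1 hmul).resolve_right
    (mul_ne_zero (zCoeff_ne_zero K k) (by simpa using he))
  rw [hr, map_zero, zero_mul]

end CharZero

end WeylAlgebra

theorem mem_of_maximal_commutative {K A : Type*} [CommSemiring K] [Semiring A] [Algebra K A]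
    {S : Subalgebra K A}
    (hS : Maximal (fun T : Subalgebra K A => ∀ a ∈ T, ∀ b ∈ T, a * b = b * a) S)
    {a : A} (ha : ∀ b ∈ S, Commute a b) : a ∈ S := by
  have hcomm : ∀ b ∈ insert a (S : Set A), ∀ c ∈ insert a (S : Set A), b * c = c * b := by
    rintro b (rfl | hb) c (rfl | hc)
    · rfl
    · exact ha c hc
    · exact (ha b hb).symm
    · exact hS.prop b hb c hc
  have := Algebra.isMulCommutative_adjoin K hcomm
  have hle : S ≤ Algebra.adjoin K (insert a (S : Set A)) :=
    fun b hb => Algebra.subset_adjoin (Set.mem_insert_of_mem _ hb)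
  exact hS.le_of_ge (fun b hb c hc => setLike_mul_comm hb hc) hle
    (Algebra.subset_adjoin (Set.mem_insert _ _))

/-! ### The canonical representation of `A(Γ)` -/

namespace Multiquiver

open TGWDatum TGWDatum.Construction
open WeylAlgebra (shift shift_shift rising zCoeff polyHom)

variable {V E : Type*} (Γ : Multiquiver V E)

theorem multAt_t_eq_zero_or (e : E) (v : V) : multAt (Γ.t e) v = 0 ∨ multAt (Γ.s e) v = 0 := by
  by_contra! h
  obtain ⟨m, hm⟩ := multAt_ne_zero h.1
  obtain ⟨n, hn⟩ := multAt_ne_zero h.2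
  exact Γ.no_loops e v n v m hn hm rfl

theorem multAt_eq_zero_or (o : Option (V × ℕ+)) {v w : V} (h : v ≠ w) :
    multAt o v = 0 ∨ multAt o w = 0 := by
  by_contra! h'
  obtain ⟨m, hm⟩ := multAt_ne_zero h'.1
  obtain ⟨n, hn⟩ := multAt_ne_zero h'.2
  rw [hm] at hn
  simp only [Option.some.injEq, Prod.mk.injEq] at hn
  exact h hn.1

theorem entry_mul_entry_nonpos (e : E) {v w : V} (h : v ≠ w) : Γ.entry e v * Γ.entry e w ≤ 0 := by
  unfold entry
  rcases multAt_eq_zero_or (Γ.t e) h with ht | ht <;>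
  rcases multAt_eq_zero_or (Γ.s e) h with hs | hs
  · simp [ht, hs]
  · simpa [ht, hs] using by positivity
  · simpa [ht, hs] using by positivity
  · simp [ht, hs]

theorem column_apply (v : V) (e : E) : Γ.column v e = Γ.entry e v := rfl

theorem γ_single (v : V) : Γ.γ (Finsupp.single v 1) = Γ.column v := by simp [γ]

theorem support_column_subset (v : V) :
    (Γ.column v).support ⊆ (Γ.finite_incident v).toFinset := by
  intro e he
  rw [Finsupp.mem_support_iff, column_apply, entry] at he
  rw [Set.Finite.mem_toFinset]
  by_cases h : multAt (Γ.t e) v = 0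
  · exact .inl (multAt_ne_zero fun h' => he (by simp [h, h']))
  · exact .inr (multAt_ne_zero h)

variable (K : Type*) [Field K]

theorem σ_apply (v : V) (r : MvPolynomial E K) : Γ.σ K v r = shift (Γ.column v) r := rfl

theorem σ_symm_apply (v : V) (r : MvPolynomial E K) :
    (Γ.σ K v).symm r = shift (-Γ.column v) r := by
  rw [AlgEquiv.symm_apply_eq, σ_apply, shift_shift]
  simp

theorem rising_mul_shift_rising_eq_uEdge (e : E) (v : V) :
    rising K e (Γ.entry e v).toNat * shift (-Γ.column v) (rising K e (-Γ.entry e v).toNat) =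
      Γ.uEdge K e v := by
  rw [WeylAlgebra.shift_rising, uEdge, rising, Finsupp.neg_apply, column_apply, entry]
  rcases Γ.multAt_t_eq_zero_or e v with ht | hs
  · simp only [ht, Nat.cast_zero, zero_sub, neg_neg, Int.toNat_neg_natCast, Finset.range_zero,
      Finset.prod_empty, one_mul, Int.toNat_natCast]
    rw [← Finset.prod_range_reflect]
    refine Finset.prod_congr rfl fun i hi => ?_
    rw [Nat.sub_sub, Nat.cast_sub (by rw [Finset.mem_range] at hi; lia)]
    simp only [Int.cast_natCast, map_natCast, Nat.cast_add, Nat.cast_one, map_sub, map_add, map_one]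
    ring
  · simp [hs]

theorem zCoeff_mul_shift_zCoeff_column (v : V) :
    zCoeff K (-Γ.column v) * shift (-Γ.column v) (zCoeff K (Γ.column v)) = Γ.tElt K v := by
  have h := Γ.support_column_subset v
  rw [WeylAlgebra.zCoeff_eq_prod K h,
    WeylAlgebra.zCoeff_eq_prod K (Finsupp.support_neg (Γ.column v) ▸ h), map_prod,
    ← Finset.prod_mul_distrib, tElt]
  refine Finset.prod_congr rfl fun e _ => ?_
  rw [Finsupp.neg_apply, neg_neg, column_apply, rising_mul_shift_rising_eq_uEdge]

theorem commute_z_column_z_neg_column {v w : V} (h : v ≠ w) :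
    Commute (WeylAlgebra.z K (Γ.column v)) (WeylAlgebra.z K (-Γ.column w)) :=
  WeylAlgebra.commute_z_z_of_mul_nonneg K fun e => by
    rw [Finsupp.neg_apply, mul_neg, Left.nonneg_neg_iff]
    exact Γ.entry_mul_entry_nonpos e h

variable {Γ K} in
theorem IsCanonicalRep.ext {φ ψ : Γ.Alg K →ₐ[K] WeylAlgebra K E} (hφ : Γ.IsCanonicalRep φ)
    (hψ : Γ.IsCanonicalRep ψ) : φ = ψ := by
  have hρ : φ.comp (Γ.ρ K) = ψ.comp (Γ.ρ K) := by
    ext e : 1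
    exact (hφ.map_u e).trans (hψ.map_u e).symm
  refine TGWAlgebra.hom_ext fun g => ?_
  cases g with
  | coeff r => exact DFunLike.congr_fun hρ r
  | X v => exact (hφ.map_X v).trans (hψ.map_X v).symm
  | Y v => exact (hφ.map_Y v).trans (hψ.map_Y v).symm

variable [CharZero K]

theorem isRep_z : (Γ.datum K).IsRep 1 (polyHom K E)
    (fun v => WeylAlgebra.z K (Γ.column v)) (fun v => WeylAlgebra.z K (-Γ.column v)) where
  x_coeff v r := WeylAlgebra.z_mul_polyHom K _ r
  y_coeff v r := by
    rw [WeylAlgebra.z_mul_polyHom, ← σ_symm_apply]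
    rfl
  y_x v := by
    rw [WeylAlgebra.z_neg_mul_z, zCoeff_mul_shift_zCoeff_column]
    rfl
  x_y v := by
    have h := WeylAlgebra.z_neg_mul_z K (-Γ.column v)
    rw [neg_neg] at h
    rw [h]
    change _ = polyHom K E (shift (Γ.column v) (Γ.tElt K v))
    rw [← zCoeff_mul_shift_zCoeff_column, map_mul (shift _), shift_shift, add_neg_cancel,
      WeylAlgebra.shift_zero, mul_comm]
  x_y_of_ne v w h := by
    rw [Pi.one_apply, Pi.one_apply, one_smul]
    exact (Γ.commute_z_column_z_neg_column K h).eq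

theorem isRep_z_regular : (Γ.isRep_z K).Regular where
  injective := WeylAlgebra.polyHom_injective K E
  isLeftRegular_x _ := WeylAlgebra.isLeftRegular_z K _
  isLeftRegular_y _ := WeylAlgebra.isLeftRegular_z K _

/-- The canonical representation `φ_Γ` of `A(Γ)` by differential operators. -/
def canonicalRep : Γ.Alg K →ₐ[K] WeylAlgebra K E := (Γ.isRep_z_regular K).hom

theorem canonicalRep_ρ (r : MvPolynomial E K) :
    Γ.canonicalRep K (Γ.ρ K r) = polyHom K E r :=
  (Γ.isRep_z_regular K).hom_gen (.coeff r)

theorem isCanonicalRep_canonicalRep : Γ.IsCanonicalRep (Γ.canonicalRep K) where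
  map_X v := by
    rw [γ_single]
    exact (Γ.isRep_z_regular K).hom_gen (.X v)
  map_Y v := by
    rw [γ_single]
    exact (Γ.isRep_z_regular K).hom_gen (.Y v)
  map_u e := by rw [canonicalRep_ρ, WeylAlgebra.polyHom_X]

theorem lift_mem_component {d : V →₀ ℤ} {a : (Γ.datum K).Construction 1}
    (ha : a ∈ component (Γ.datum K) 1 d) :
    lift (Γ.isRep_z K) a ∈ WeylAlgebra.component K (Γ.γ d) := by
  refine (Γ.isRep_z K).lift_mem_graded Γ.γ.toAddMonoidHom
    (WeylAlgebra.polyHom_mem_component_zero K) (fun v => ?_) (fun v => ?_) ha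
  · rw [LinearMap.toAddMonoidHom_coe, γ_single]
    exact WeylAlgebra.z_mem_component K _
  · rw [LinearMap.toAddMonoidHom_coe, map_neg, γ_single]
    exact WeylAlgebra.z_mem_component K _

theorem coeff_gradedHom_mem_component (a : Γ.Alg K) (d : V →₀ ℤ) :
    ((Γ.isRep_z_regular K).gradedHom a).coeff d ∈ WeylAlgebra.component K (Γ.γ d) := by
  obtain ⟨b, hb, hba⟩ := (Γ.isRep_z_regular K).exists_lift_eq_coeff_gradedHom a d
  exact hba ▸ Γ.lift_mem_component K hb

theorem canonicalRep_injective (h : Function.Injective Γ.γ) :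
    Function.Injective (Γ.canonicalRep K) := by
  refine (injective_iff_map_eq_zero _).2 fun a ha => ?_
  refine (Γ.isRep_z_regular K).gradedHom_injective ?_
  rw [map_zero, ← AddMonoidAlgebra.coeff_eq_zero]
  set c := ((Γ.isRep_z_regular K).gradedHom a).coeff with hc
  have hsum : ∑ d ∈ c.support, c d = 0 := by
    rw [← ha, canonicalRep, IsRep.Regular.hom, AlgHom.comp_apply, IsRep.forgetDegree_eq_sum, ← hc]
    rfl
  have hindep := (iSupIndep_iff_finsetSum_eq_zero_imp_eq_zero _).1
    ((WeylAlgebra.iSupIndep_component K E).comp h) c.support c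
    (fun d _ => Γ.coeff_gradedHom_mem_component K a d) hsum
  ext d
  by_contra hd
  exact hd (hindep d (Finsupp.mem_support_iff.2 hd))

-- A regular element of degree `d` with `γ d = 0` acts like an element of `R_E`, from which only
-- its degree distinguishes it.
theorem exists_notMem_range_ρ_of_γ_eq_zero {d : V →₀ ℤ} (hd : d ≠ 0) (h : Γ.γ d = 0) :
    ∃ a : Γ.Alg K, a ∉ (Γ.ρ K).range ∧ (∀ r, Commute a (Γ.ρ K r)) ∧
      ∃ p, Γ.canonicalRep K a = Γ.canonicalRep K (Γ.ρ K p) := by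
  have hreg := Γ.isRep_z_regular K
  obtain ⟨c, hc, hcreg⟩ := hreg.exists_mem_component d
  obtain ⟨p, hp⟩ : ∃ p, polyHom K E p = lift (Γ.isRep_z K) c := by
    simpa [h, WeylAlgebra.mem_component] using Γ.lift_mem_component K hc
  have hgraded : hreg.gradedHom (Ideal.Quotient.mk _ c) =
      AddMonoidAlgebra.single d (lift (Γ.isRep_z K) c) :=
    (Γ.isRep_z K).lift_graded_of_mem hc
  have hρ (r) : hreg.gradedHom (Γ.ρ K r) = AddMonoidAlgebra.single 0 (polyHom K E r) :=
    hreg.gradedHom_ρ r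
  refine ⟨Ideal.Quotient.mk _ c, ?_, fun r => hreg.gradedHom_injective ?_, p, ?_⟩
  · rintro ⟨r, hr⟩
    have hzero : lift (Γ.isRep_z K) c = 0 := by
      have hcoeff := congrArg (fun b => AddMonoidAlgebra.coeff b d)
        ((hρ r).symm.trans ((congrArg hreg.gradedHom hr).trans hgraded))
      simpa only [AddMonoidAlgebra.coeff_single, Finsupp.single_eq_same,
        Finsupp.single_eq_of_ne hd] using hcoeff.symm
    have : Nontrivial (WeylAlgebra K E) := hreg.injective.nontrivial
    exact hcreg.ne_zero hzero
  · rw [map_mul, map_mul, hρ, hgraded, AddMonoidAlgebra.single_mul_single,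
      AddMonoidAlgebra.single_mul_single, ← hp, ← map_mul, ← map_mul, mul_comm p, add_comm d]
  · rw [canonicalRep_ρ, canonicalRep, IsRep.Regular.hom_mk, hp]

theorem γ_injective_of_canonicalRep_injective (h : Function.Injective (Γ.canonicalRep K)) :
    Function.Injective Γ.γ := by
  refine (injective_iff_map_eq_zero _).2 fun d hd => ?_
  by_contra hd0
  obtain ⟨a, ha, -, p, hp⟩ := Γ.exists_notMem_range_ρ_of_γ_eq_zero K hd0 hd
  exact ha ⟨p, (h hp).symm⟩

theorem γ_injective_of_maximal (h : Maximal
    (fun S : Subalgebra K (Γ.Alg K) => ∀ a ∈ S, ∀ b ∈ S, a * b = b * a) (Γ.ρ K).range) :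
    Function.Injective Γ.γ := by
  refine (injective_iff_map_eq_zero _).2 fun d hd => ?_
  by_contra hd0
  obtain ⟨a, ha, hcomm, -⟩ := Γ.exists_notMem_range_ρ_of_γ_eq_zero K hd0 hd
  refine ha (mem_of_maximal_commutative h ?_)
  rintro _ ⟨r, rfl⟩
  exact hcomm r

theorem mem_range_ρ_of_commute (h : Function.Injective Γ.γ) {a : Γ.Alg K}
    (ha : ∀ e, Commute a (Γ.ρ K (MvPolynomial.X e))) : a ∈ (Γ.ρ K).range := by
  have hreg := Γ.isRep_z_regular K
  obtain ⟨p, hp⟩ : ∃ p, polyHom K E p = (hreg.gradedHom a).coeff 0 := by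
    simpa [WeylAlgebra.mem_component] using Γ.coeff_gradedHom_mem_component K a 0
  have hcoeff (d) (hd : d ≠ 0) : (hreg.gradedHom a).coeff d = 0 := by
    obtain ⟨e, he⟩ := Finsupp.ne_iff.1 ((map_ne_zero_iff Γ.γ h).2 hd)
    refine WeylAlgebra.eq_zero_of_mem_component_of_commute K
      (Γ.coeff_gradedHom_mem_component K a d) he ?_
    have hρ := hreg.gradedHom_ρ (MvPolynomial.X e)
    have hcomm := congrArg (fun b => (hreg.gradedHom b).coeff d) (ha e).eq
    simpa only [Commute, SemiconjBy, map_mul, ρ, hρ, WeylAlgebra.polyHom_X,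
      AddMonoidAlgebra.coeff_mul_single_zero, AddMonoidAlgebra.coeff_single_zero_mul] using hcomm
  refine ⟨p, hreg.gradedHom_injective ((hreg.gradedHom_ρ p).trans ?_)⟩
  rw [← AddMonoidAlgebra.coeff_inj, AddMonoidAlgebra.coeff_single]
  ext d
  rcases eq_or_ne d 0 with rfl | hd
  · rw [Finsupp.single_eq_same, hp]
  · rw [Finsupp.single_eq_of_ne hd, hcoeff d hd]

theorem maximal_of_γ_injective (h : Function.Injective Γ.γ) : Maximal
    (fun S : Subalgebra K (Γ.Alg K) => ∀ a ∈ S, ∀ b ∈ S, a * b = b * a) (Γ.ρ K).range := by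
  refine ⟨?_, fun S hS hle a ha => ?_⟩
  · rintro _ ⟨r, rfl⟩ _ ⟨s, rfl⟩
    exact (Commute.all r s).map (Γ.ρ K)
  · exact Γ.mem_range_ρ_of_commute K h fun e => hS a ha _ (hle ⟨_, rfl⟩)

end Multiquiver

theorem exists_eq_mul_finRotate {G : Type*} [CommGroup G] {n : ℕ} {c : Fin n → G}
    (hc : ∏ i, c i = 1) : ∃ k : Fin n → G, ∀ i, k (finRotate n i) = k i * c i := by
  rcases n with _ | n
  · exact ⟨1, fun i => i.elim0⟩
  refine ⟨fun i => Fin.partialProd c i.castSucc, Fin.lastCases ?_ fun i => ?_⟩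
  · have hlast : Fin.partialProd c (Fin.last (n + 1)) = 1 := by
      rw [Fin.partialProd, Fin.val_last, List.take_of_length_le (by simp), List.prod_ofFn, hc]
    beta_reduce
    rw [finRotate_last, Fin.castSucc_zero, Fin.partialProd_zero, ← Fin.partialProd_succ,
      Fin.succ_last, hlast]
  · rw [finRotate_apply, Fin.coeSucc_eq_succ, ← Fin.partialProd_succ, Fin.succ_castSucc]

theorem pnat_cast_ne_zero (m : ℕ+) : ((m : ℕ) : ℚ) ≠ 0 := by simp

theorem pnat_prod_cast_inj {ι : Type*} {s : Finset ι} {a b : ι → ℕ+} :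
    ∏ i ∈ s, ((a i : ℕ) : ℚ) = ∏ i ∈ s, ((b i : ℕ) : ℚ) ↔ ∏ i ∈ s, a i = ∏ i ∈ s, b i := by
  rw [← PNat.coe_inj, ← Nat.cast_inj (R := ℚ)]
  push_cast
  rfl

namespace Multiquiver

variable {V E : Type*} (Γ : Multiquiver V E)

/-! ### Potentials and balanced cycles -/

/-- The edge `e` joins `u` (with multiplicity `a`) and `v` (with multiplicity `b`), in one of the
two directions. -/
def Link (e : E) (u v : V) (a b : ℕ+) : Prop :=
  (Γ.s e = some (u, a) ∧ Γ.t e = some (v, b)) ∨ (Γ.t e = some (u, a) ∧ Γ.s e = some (v, b))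

/-- A potential is a rational function on vertices with `a k(u) = b k(v)` for every edge that joins
`u` with multiplicity `a` and `v` with multiplicity `b`. In the absence of leaves, the potentials
are the rational solutions of `γ k = 0`. -/
def IsPotential (k : V → ℚ) : Prop :=
  ∀ ⦃e u v a b⦄, Γ.Link e u v a b → ((a : ℕ) : ℚ) * k u = ((b : ℕ) : ℚ) * k v

/-- Every subgraph that is an NND cycle is balanced. -/
def NNDCyclesBalanced : Prop :=
  ∀ (V' : Set V) (E' : Set E), (Γ.subgraph V' E').IsNNDCycle →
    (Γ.subgraph V' E').IsBalancedNNDCycle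

variable {Γ}

namespace Link

variable {e : E} {u v : V} {a b : ℕ+}

theorem symm (h : Γ.Link e u v a b) : Γ.Link e v u b a :=
  h.elim (fun h => .inr ⟨h.2, h.1⟩) fun h => .inl ⟨h.2, h.1⟩

theorem ne (h : Γ.Link e u v a b) : u ≠ v :=
  h.elim (fun h => Γ.no_loops e _ _ _ _ h.1 h.2) fun h => (Γ.no_loops e _ _ _ _ h.2 h.1).symm

theorem incident (h : Γ.Link e u v a b) : Γ.Incident u e :=
  h.elim (fun h => .inl ⟨a, h.1⟩) fun h => .inr ⟨a, h.1⟩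

theorem not_isLeaf (h : Γ.Link e u v a b) : ¬Γ.IsLeaf e := by
  rcases h with ⟨hs, ht⟩ | ⟨ht, hs⟩ <;> simp [IsLeaf, hs, ht]

theorem eq_or_eq {u' v' : V} {a' b' : ℕ+} (h : Γ.Link e u v a b) (h' : Γ.Link e u' v' a' b') :
    (u = u' ∧ v = v' ∧ a = a' ∧ b = b') ∨ (u = v' ∧ v = u' ∧ a = b' ∧ b = a') := by
  rcases h with ⟨hu, hv⟩ | ⟨hu, hv⟩ <;> rcases h' with ⟨hu', hv'⟩ | ⟨hu', hv'⟩
  all_goals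
    simp only [hu, hv, Option.some.injEq, Prod.mk.injEq] at hu' hv'
    tauto

end Link

theorem restrictEnd_eq_some_iff {V' : Set V} {o : Option (V × ℕ+)} {v : V'} {n : ℕ+} :
    restrictEnd V' o = some (v, n) ↔ o = some (v.1, n) := by
  refine ⟨restrictEnd_eq_some, ?_⟩
  rintro rfl
  simp [restrictEnd]

theorem link_subgraph_iff {V' : Set V} {E' : Set E} {e : E'} {u v : V'} {a b : ℕ+} :
    (Γ.subgraph V' E').Link e u v a b ↔ Γ.Link e u v a b := by
  simp only [Link, subgraph, restrictEnd_eq_some_iff]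

theorem isPotential_intCast_iff {k : V → ℤ} : Γ.IsPotential (fun v => k v) ↔
    ∀ ⦃e u v a b⦄, Γ.Link e u v a b → (a : ℤ) * k u = (b : ℤ) * k v := by
  simp only [IsPotential]
  norm_cast

theorem IsPotential.subgraph {k : V → ℚ} (hk : Γ.IsPotential k) (V' : Set V) (E' : Set E) :
    (Γ.subgraph V' E').IsPotential fun v => k v :=
  fun _ _ _ _ _ h => hk (link_subgraph_iff.1 h)

theorem SignEquivalent.exists_equiv_link_iff {V₁ E₁ V₂ E₂ : Type*} {Γ₁ : Multiquiver V₁ E₁}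
    {Γ₂ : Multiquiver V₂ E₂} (h : SignEquivalent Γ₁ Γ₂) :
    ∃ (f : V₁ ≃ V₂) (g : E₁ ≃ E₂), ∀ e u v a b,
      Γ₂.Link (g e) (f u) (f v) a b ↔ Γ₁.Link e u v a b := by
  obtain ⟨f, g, hfg⟩ := h
  have hmap (o : Option (V₁ × ℕ+)) (u a) :
      o.map (Prod.map f id) = some (f u, a) ↔ o = some (u, a) :=
    (Option.map_injective (f.injective.prodMap Function.injective_id)).eq_iff (b := some (u, a))
  refine ⟨f, g, fun e u v a b => ?_⟩
  rcases hfg e with ⟨hs, ht⟩ | ⟨hs, ht⟩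
  · simp only [Link, hs, ht, hmap]
  · simp only [Link, hs, ht, hmap, or_comm]

theorem SignEquivalent.exists_equiv_isPotential_iff {V₁ E₁ V₂ E₂ : Type*} {Γ₁ : Multiquiver V₁ E₁}
    {Γ₂ : Multiquiver V₂ E₂} (h : SignEquivalent Γ₁ Γ₂) :
    ∃ f : V₁ ≃ V₂, ∀ k : V₂ → ℚ, Γ₁.IsPotential (k ∘ f) ↔ Γ₂.IsPotential k := by
  obtain ⟨f, g, hlink⟩ := h.exists_equiv_link_iff
  refine ⟨f, fun k => ?_⟩
  simp only [IsPotential, g.forall_congr_left, f.forall_congr_left, ← hlink,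
    Equiv.apply_symm_apply, Function.comp_apply]

theorem IsPotential.prod_eq_prod {k : V → ℚ} (hk : Γ.IsPotential k) (hk0 : ∀ v, k v ≠ 0)
    {ι : Type*} [Fintype ι] (σ : Equiv.Perm ι) {v : ι → V} {e : ι → E} {a b : ι → ℕ+}
    (h : ∀ i, Γ.Link (e i) (v i) (v (σ i)) (a i) (b i)) : ∏ i, a i = ∏ i, b i := by
  have hprod := Finset.prod_congr (s₁ := .univ) rfl fun i _ => hk (h i)
  rw [Finset.prod_mul_distrib, Finset.prod_mul_distrib, Equiv.prod_comp σ fun i => k (v i)] at hprod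
  exact pnat_prod_cast_inj.1
    (mul_right_cancel₀ (Finset.prod_ne_zero_iff.2 fun i _ => hk0 (v i)) hprod)

theorem IsDirectedCycleVia.link {n : ℕ} {v : Fin n ≃ V} {e : Fin n ≃ E} {a b : Fin n → ℕ+}
    (h : Γ.IsDirectedCycleVia v e a b) (i : Fin n) :
    Γ.Link (e i) (v i) (v (finRotate n i)) (a i) (b i) :=
  .inl (h i)

theorem IsBalancedDirectedCycle.exists_isPotential (h : Γ.IsBalancedDirectedCycle) :
    ∃ k : V → ℚ, Γ.IsPotential k ∧ ∀ v, k v ≠ 0 := by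
  obtain ⟨n, v, e, a, b, -, hvia, hab⟩ := h
  let unit (m : ℕ+) : ℚˣ := Units.mk0 ((m : ℕ) : ℚ) (pnat_cast_ne_zero m)
  have hprod : ∏ i, unit (a i) / unit (b i) = 1 := by
    rw [Finset.prod_div_distrib, div_eq_one]
    ext
    simpa [unit, Units.coe_prod] using pnat_prod_cast_inj.2 hab
  obtain ⟨k, hk⟩ := exists_eq_mul_finRotate hprod
  have hstep (i) : ((a i : ℕ) : ℚ) * k i = ((b i : ℕ) : ℚ) * k (finRotate n i) := by
    have hb := pnat_cast_ne_zero (b i)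
    rw [hk]
    simp only [unit, Units.val_mul, Units.val_div_eq_div_val, Units.val_mk0]
    field_simp
  refine ⟨fun w => k (v.symm w), fun f u w c d hlink => ?_, fun w => Units.ne_zero _⟩
  obtain ⟨i, rfl⟩ := e.surjective f
  rcases (hvia.link i).eq_or_eq hlink with ⟨rfl, rfl, rfl, rfl⟩ | ⟨rfl, rfl, rfl, rfl⟩
  · simpa using hstep i
  · simpa using (hstep i).symm

theorem IsBalancedNNDCycle.exists_isPotential (h : Γ.IsBalancedNNDCycle) :
    ∃ k : V → ℚ, Γ.IsPotential k ∧ ∀ v, k v ≠ 0 := by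
  obtain ⟨Γ', hΓ', hsign⟩ := h
  obtain ⟨k, hk, hk0⟩ := hΓ'.exists_isPotential
  obtain ⟨f, hf⟩ := hsign.exists_equiv_isPotential_iff
  exact ⟨k ∘ f, (hf k).2 hk, fun v => hk0 (f v)⟩

theorem IsNNDCycle.isBalancedNNDCycle (h : Γ.IsNNDCycle) {k : V → ℚ} (hk : Γ.IsPotential k)
    (hk0 : ∀ v, k v ≠ 0) : Γ.IsBalancedNNDCycle := by
  obtain ⟨Γ', ⟨n, v, e, a, b, hn, hvia⟩, hsign⟩ := h
  obtain ⟨f, hf⟩ := hsign.exists_equiv_isPotential_iff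
  have hpot : Γ'.IsPotential (k ∘ f.symm) := (hf _).1 (by simpa [Function.comp_def] using hk)
  exact ⟨Γ', ⟨n, v, e, a, b, hn, hvia,
    hpot.prod_eq_prod (fun v => hk0 (f.symm v)) (finRotate n) hvia.link⟩, hsign⟩

theorem isNNDCycle_of_link {n : ℕ} (hn : 0 < n) (v : Fin n ≃ V) (e : Fin n ≃ E) (a b : Fin n → ℕ+)
    (h : ∀ i, Γ.Link (e i) (v i) (v (finRotate n i)) (a i) (b i)) : Γ.IsNNDCycle := by
  have := Finite.of_equiv _ e
  let Γ' : Multiquiver V E :=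
    { s f := some (v (e.symm f), a (e.symm f))
      t f := some (v (finRotate n (e.symm f)), b (e.symm f))
      no_loops f u m w p hs ht := by
        simp only [Option.some.injEq, Prod.mk.injEq] at hs ht
        rw [← hs.1, ← ht.1]
        exact (h (e.symm f)).ne
      finite_s _ := Set.toFinite _
      finite_t _ := Set.toFinite _ }
  refine ⟨Γ', ⟨n, v, e, a, b, hn, fun i => by simp [Γ']⟩, Equiv.refl _, Equiv.refl _, fun f => ?_⟩
  obtain ⟨i, rfl⟩ := e.surjective f
  rcases h i with ⟨hs, ht⟩ | ⟨ht, hs⟩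
  · exact .inl (by simp [Γ', hs, ht])
  · exact .inr (by simp [Γ', hs, ht])

theorem NNDCyclesBalanced.prod_eq_prod (hbal : Γ.NNDCyclesBalanced) {n : ℕ} {v : Fin n → V}
    {e : Fin n → E} {a b : Fin n → ℕ+}
    (h : ∀ i, Γ.Link (e i) (v i) (v (finRotate n i)) (a i) (b i)) (hv : Function.Injective v)
    (he : Function.Injective e) : ∏ i, a i = ∏ i, b i := by
  rcases n.eq_zero_or_pos with rfl | hn
  · rfl
  have hlink (i) : (Γ.subgraph (Set.range v) (Set.range e)).Link (Equiv.ofInjective e he i)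
      (Equiv.ofInjective v hv i) (Equiv.ofInjective v hv (finRotate n i)) (a i) (b i) :=
    link_subgraph_iff.2 (h i)
  obtain ⟨k, hk, hk0⟩ := (hbal _ _ (isNNDCycle_of_link hn _ _ a b hlink)).exists_isPotential
  exact hk.prod_eq_prod hk0 (finRotate n) hlink

/-! ### Holonomy -/

variable (Γ) in
/-- The first `n` of the edges `e` form a path through the distinct vertices `w 0, …, w n`; the
values of the sequences beyond that range are irrelevant. -/
structure IsPath (n : ℕ) (w : ℕ → V) (e : ℕ → E) (a b : ℕ → ℕ+) : Prop where
  link : ∀ i < n, Γ.Link (e i) (w i) (w (i + 1)) (a i) (b i)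
  injOn : Set.InjOn w (Set.Iic n)

namespace IsPath

variable {n : ℕ} {w : ℕ → V} {e : ℕ → E} {a b : ℕ → ℕ+}

theorem take (h : Γ.IsPath n w e a b) {m : ℕ} (hm : m ≤ n) : Γ.IsPath m w e a b where
  link i hi := h.link i (hi.trans_le hm)
  injOn := h.injOn.mono (Set.Iic_subset_Iic.2 hm)

theorem drop {m : ℕ} (h : Γ.IsPath (m + n) w e a b) :
    Γ.IsPath n (fun i => w (m + i)) (fun i => e (m + i)) (fun i => a (m + i))
      (fun i => b (m + i)) where
  link i hi := h.link (m + i) (by lia)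
  injOn i hi j hj hij := by
    rw [Set.mem_Iic] at hi hj
    exact Nat.add_left_cancel
      (h.injOn (show m + i ≤ m + n by lia) (show m + j ≤ m + n by lia) hij)

theorem cons (h : Γ.IsPath n w e a b) {u : V} (hu : ∀ i ≤ n, w i ≠ u) {f : E} {p q : ℕ+}
    (hf : Γ.Link f u (w 0) p q) :
    Γ.IsPath (n + 1) (fun i => i.casesOn u w) (fun i => i.casesOn f e) (fun i => i.casesOn p a)
      (fun i => i.casesOn q b) where
  link i hi := by
    cases i with
    | zero => exact hf
    | succ i => exact h.link i (by lia)
  injOn i hi j hj hij := by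
    rw [Set.mem_Iic] at hi hj
    cases i <;> cases j
    · rfl
    · exact absurd hij.symm (hu _ (by lia))
    · exact absurd hij (hu _ (by lia))
    · exact congrArg _ (h.injOn (by simpa using hi) (by simpa using hj) hij)

theorem injOn_edge (h : Γ.IsPath n w e a b) : Set.InjOn e (Set.Iio n) := by
  intro i hi j hj hij
  rw [Set.mem_Iio] at hi hj
  rcases (h.link i hi).eq_or_eq (hij ▸ h.link j hj) with ⟨hw, -⟩ | ⟨hw, hw', -⟩
  · exact h.injOn hi.le hj.le hw
  · have h₁ := h.injOn (show i ≤ n by lia) (show j + 1 ≤ n by lia) hw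
    have h₂ := h.injOn (show i + 1 ≤ n by lia) (show j ≤ n by lia) hw'
    lia

theorem prod_mul_eq_of_link (hbal : Γ.NNDCyclesBalanced) (h : Γ.IsPath n w e a b) {f : E}
    {p q : ℕ+} (hf : Γ.Link f (w n) (w 0) p q) :
    (∏ i : Fin n, a i) * p = (∏ i : Fin n, b i) * q := by
  by_cases hback : ∃ j < n, e j = f
  · obtain ⟨j, hj, rfl⟩ := hback
    rcases (h.link j hj).eq_or_eq hf with ⟨hw, -⟩ | ⟨hw, hw', rfl, rfl⟩
    · exact absurd (h.injOn hj.le Set.self_mem_Iic hw) hj.ne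
    · obtain rfl : j = 0 := h.injOn hj.le n.zero_le hw
      obtain rfl : 0 + 1 = n := h.injOn hj Set.self_mem_Iic hw'
      simp [mul_comm]
  · push Not at hback
    rw [← Fin.prod_snoc, ← Fin.prod_snoc]
    refine hbal.prod_eq_prod (v := fun i => w i) (e := Fin.snoc (fun i => e i) f) ?_
      (fun i j hij => Fin.ext (h.injOn (Nat.le_of_lt_succ i.2) (Nat.le_of_lt_succ j.2) hij)) ?_
    · refine Fin.lastCases (by simpa using hf) fun i => ?_
      simpa [finRotate_apply] using h.link i i.2
    · intro i j
      induction i using Fin.lastCases <;> induction j using Fin.lastCases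
      · simp
      · simpa using fun hij => absurd hij.symm (hback _ (Fin.is_lt _))
      · simpa using fun hij => absurd hij (hback _ (Fin.is_lt _))
      · simpa using fun hij => Fin.ext (h.injOn_edge (Fin.is_lt _) (Fin.is_lt _) hij)

end IsPath

variable (Γ) in
/-- `Γ.Holonomy u v c`: there is a walk from `u` to `v` along which potentials are multiplied
by `c`. -/
inductive Holonomy : V → V → ℚ → Prop
  | refl (u : V) : Holonomy u u 1
  | cons {u v w : V} {c : ℚ} {e : E} {a b : ℕ+} (hl : Γ.Link e u v a b) (h : Holonomy v w c) :
      Holonomy u w (((a : ℕ) : ℚ) / (b : ℕ) * c)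

theorem Link.holonomy {e : E} {u v : V} {a b : ℕ+} (h : Γ.Link e u v a b) :
    Γ.Holonomy u v (((a : ℕ) : ℚ) / (b : ℕ)) := by
  simpa using Holonomy.cons h (.refl v)

namespace Holonomy

variable {u v w : V} {c d : ℚ}

theorem trans (h : Γ.Holonomy u v c) (h' : Γ.Holonomy v w d) : Γ.Holonomy u w (c * d) := by
  induction h with
  | refl => simpa using h'
  | cons hl _ ih => simpa only [mul_assoc] using cons hl (ih h')

theorem symm (h : Γ.Holonomy u v c) : Γ.Holonomy v u c⁻¹ := by
  induction h with
  | refl => simpa using refl _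
  | cons hl _ ih => simpa [mul_comm] using ih.trans hl.symm.holonomy

theorem ne_zero (h : Γ.Holonomy u v c) : c ≠ 0 := by
  induction h with
  | refl => exact one_ne_zero
  | cons _ _ ih => exact mul_ne_zero (div_ne_zero (pnat_cast_ne_zero _) (pnat_cast_ne_zero _)) ih

-- If the edge put in front of a path returns to the path, then the cycle that it closes is
-- balanced, so the rest of the path has the same holonomy.
theorem exists_isPath [Nonempty E] (hbal : Γ.NNDCyclesBalanced) (h : Γ.Holonomy u v c) :
    ∃ (n : ℕ) (w : ℕ → V) (e : ℕ → E) (a b : ℕ → ℕ+), Γ.IsPath n w e a b ∧ w 0 = u ∧ w n = v ∧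
      c = ∏ i ∈ Finset.range n, ((a i : ℕ) : ℚ) / (b i : ℕ) := by
  induction h with
  | refl u =>
    exact ⟨0, fun _ => u, fun _ => Classical.arbitrary E, 1, 1,
      ⟨by simp, fun i hi j hj _ => by simp_all⟩, rfl, rfl, by simp⟩
  | @cons u _ _ _ f p q hl _ ih =>
    obtain ⟨n, w, e, a, b, hpath, rfl, rfl, rfl⟩ := ih
    by_cases hu : ∀ i ≤ n, w i ≠ u
    · refine ⟨n + 1, _, _, _, _, hpath.cons hu hl, rfl, rfl, ?_⟩
      rw [Finset.prod_range_succ', mul_comm]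
      rfl
    push Not at hu
    obtain ⟨m, hm, rfl⟩ := hu
    obtain ⟨n, rfl⟩ := Nat.exists_eq_add_of_le hm
    refine ⟨n, _, _, _, _, hpath.drop, rfl, rfl, ?_⟩
    have hcycle : (∏ i ∈ Finset.range m, ((a i : ℕ) : ℚ)) * (p : ℕ) =
        (∏ i ∈ Finset.range m, ((b i : ℕ) : ℚ)) * (q : ℕ) := by
      rw [Finset.prod_range, Finset.prod_range]
      exact_mod_cast congrArg PNat.val ((hpath.take hm).prod_mul_eq_of_link hbal hl)
    have hq := pnat_cast_ne_zero q
    have hb : ∏ i ∈ Finset.range m, ((b i : ℕ) : ℚ) ≠ 0 :=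
      Finset.prod_ne_zero_iff.2 fun i _ => pnat_cast_ne_zero (b i)
    rw [Finset.prod_range_add, ← mul_assoc, Finset.prod_div_distrib, div_mul_div_comm,
      mul_comm (p : ℚ), hcycle, mul_comm, mul_comm (q : ℚ), div_self (mul_ne_zero hb hq), mul_one]

theorem eq_one (hbal : Γ.NNDCyclesBalanced) (h : Γ.Holonomy u u c) : c = 1 := by
  rcases isEmpty_or_nonempty E with hE | hE
  · cases h with
    | refl => rfl
    | @cons _ _ _ _ e => exact hE.elim e
  · obtain ⟨n, w, e, a, b, hpath, rfl, hn, rfl⟩ := h.exists_isPath hbal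
    obtain rfl : n = 0 := hpath.injOn Set.self_mem_Iic n.zero_le hn
    exact Finset.prod_range_zero _

end Holonomy

theorem NNDCyclesBalanced.exists_isPotential (hbal : Γ.NNDCyclesBalanced) (u : V)
    (hconn : ∀ v, ∃ c, Γ.Holonomy u v c) : ∃ k : V → ℚ, Γ.IsPotential k ∧ ∀ v, k v ≠ 0 := by
  choose k hk using hconn
  refine ⟨k, fun e v w a b hl => ?_, fun v => (hk v).ne_zero⟩
  have hone := (((hk v).trans hl.holonomy).trans (hk w).symm).eq_one hbal
  have hw := (hk w).ne_zero
  have hb := pnat_cast_ne_zero b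
  field_simp at hone
  linear_combination hone

theorem IsPotential.exists_int [Finite V] {k : V → ℚ} (hk : Γ.IsPotential k)
    (hk0 : ∀ v, k v ≠ 0) : ∃ z : V → ℤ, Γ.IsPotential (fun v => z v) ∧ ∀ v, z v ≠ 0 := by
  obtain ⟨N, hN⟩ := IsLocalization.exist_integer_multiples_of_finite (nonZeroDivisors ℤ) k
  choose z hz using hN
  have hzk (v) : (z v : ℚ) = (N : ℤ) * k v := by simpa using hz v
  refine ⟨z, fun e u v a b hl => ?_, fun v hv => ?_⟩
  · simp only [hzk]
    linear_combination (N : ℤ) * hk hl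
  · have hN0 : ((N : ℤ) : ℚ) ≠ 0 := by exact_mod_cast nonZeroDivisors.coe_ne_zero N
    exact mul_ne_zero hN0 (hk0 v) (by rw [← hzk, hv, Int.cast_zero])

/-! ### The kernel of the incidence matrix -/

/-- The product of the multiplicity and the value of `k` at a source or target; it is `0` if there
is none. The incidence matrix is the difference of its values at target and source. -/
def endVal (k : V →₀ ℤ) : Option (V × ℕ+) → ℤ
  | none => 0
  | some (v, n) => n * k v

theorem endVal_eq_linearCombination (k : V →₀ ℤ) (o : Option (V × ℕ+)) :
    endVal k o = Finsupp.linearCombination ℤ (fun v => (multAt o v : ℤ)) k := by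
  classical
  rcases o with _ | ⟨w, n⟩
  · simp [endVal, multAt, Finsupp.linearCombination_apply]
  · simp [endVal, multAt, Finsupp.linearCombination_apply, Finsupp.sum, mul_comm]

theorem endVal_ne_zero_iff {k : V →₀ ℤ} {o : Option (V × ℕ+)} :
    endVal k o ≠ 0 ↔ ∃ v n, o = some (v, n) ∧ k v ≠ 0 := by
  rcases o with _ | ⟨w, n⟩ <;> simp [endVal]

theorem endVal_mapDomain_val {V' : Set V} (k : V' →₀ ℤ) (o : Option (V × ℕ+)) :
    endVal (k.mapDomain Subtype.val) o = endVal k (restrictEnd V' o) := by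
  rcases o with _ | ⟨v, n⟩
  · rfl
  by_cases hv : v ∈ V'
  · rw [restrictEnd, dif_pos hv, endVal, endVal,
      ← Finsupp.mapDomain_apply Subtype.val_injective k ⟨v, hv⟩]
  · rw [restrictEnd, dif_neg hv, endVal, endVal, Finsupp.mapDomain_of_notMem_range _ _ (by simpa),
      mul_zero]

variable (Γ) in
theorem γ_apply (k : V →₀ ℤ) (e : E) : Γ.γ k e = endVal k (Γ.t e) - endVal k (Γ.s e) := by
  simp only [endVal_eq_linearCombination, γ, Finsupp.linearCombination_apply, Finsupp.sum,
    Finsupp.finsetSum_apply, Finsupp.smul_apply, column_apply, entry, smul_sub,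
    Finset.sum_sub_distrib]

theorem γ_eq_zero_iff {k : V →₀ ℤ} :
    Γ.γ k = 0 ↔ ∀ e, endVal k (Γ.t e) = endVal k (Γ.s e) := by
  simp only [Finsupp.ext_iff, γ_apply, Finsupp.zero_apply, sub_eq_zero]

theorem isPotential_of_γ_eq_zero {k : V →₀ ℤ} (hk : Γ.γ k = 0) :
    Γ.IsPotential fun v => k v := by
  refine isPotential_intCast_iff.2 ?_
  rintro e u v a b (⟨hs, ht⟩ | ⟨ht, hs⟩) <;> have he := γ_eq_zero_iff.1 hk e <;>
    rw [hs, ht, endVal, endVal] at he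
  · exact he.symm
  · exact he

theorem exists_s_t_of_not_isLeaf {e : E} (he : ¬Γ.IsLeaf e) :
    ∃ u m v n, Γ.s e = some (u, m) ∧ Γ.t e = some (v, n) := by
  rw [IsLeaf, not_or, ← ne_eq, ← ne_eq, Option.ne_none_iff_exists',
    Option.ne_none_iff_exists'] at he
  obtain ⟨⟨⟨u, m⟩, hs⟩, ⟨v, n⟩, ht⟩ := he
  exact ⟨u, m, v, n, hs, ht⟩

theorem γ_eq_zero_of_isPotential (hleaf : ∀ e, ¬Γ.IsLeaf e) {k : V →₀ ℤ}
    (hk : Γ.IsPotential fun v => k v) : Γ.γ k = 0 := by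
  refine γ_eq_zero_iff.2 fun e => ?_
  obtain ⟨u, m, v, n, hs, ht⟩ := exists_s_t_of_not_isLeaf (hleaf e)
  rw [hs, ht, endVal, endVal]
  exact (isPotential_intCast_iff.1 hk (.inl ⟨hs, ht⟩)).symm

theorem γ_mapDomain_val_eq_zero {V' : Set V} {E' : Set E}
    (hE' : ∀ v ∈ V', ∀ e, Γ.Incident v e → e ∈ E') {k : V' →₀ ℤ}
    (hk : (Γ.subgraph V' E').γ k = 0) : Γ.γ (k.mapDomain Subtype.val) = 0 := by
  refine γ_eq_zero_iff.2 fun e => ?_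
  rw [endVal_mapDomain_val, endVal_mapDomain_val]
  by_cases he : e ∈ E'
  · exact γ_eq_zero_iff.1 hk ⟨e, he⟩
  · have hend (o) (ho : ∀ v n, o = some (v, n) → Γ.Incident v e) :
        endVal k (restrictEnd V' o) = 0 := by
      by_contra h
      obtain ⟨v, n, hv, -⟩ := endVal_ne_zero_iff.1 h
      exact he (hE' v v.2 e (ho v n (restrictEnd_eq_some hv)))
    rw [hend _ fun v n h => .inr ⟨n, h⟩, hend _ fun v n h => .inl ⟨n, h⟩]

theorem Incident.connectedComponentMk_eq {v : V} {e : E} (h : Γ.Incident v e) :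
    Γ.incidenceGraph.connectedComponentMk (.inl v) =
      Γ.incidenceGraph.connectedComponentMk (.inr e) :=
  SimpleGraph.ConnectedComponent.sound (SimpleGraph.Adj.reachable (by exact h))

theorem Incident.eq_or_link {v w : V} {e : E} (hv : Γ.Incident v e) (hw : Γ.Incident w e) :
    v = w ∨ ∃ a b, Γ.Link e v w a b := by
  rcases hv with ⟨a, ha⟩ | ⟨a, ha⟩ <;> rcases hw with ⟨b, hb⟩ | ⟨b, hb⟩
  · exact .inl (congrArg Prod.fst (Option.some.inj (ha.symm.trans hb)))
  · exact .inr ⟨a, b, .inl ⟨ha, hb⟩⟩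
  · exact .inr ⟨a, b, .inr ⟨ha, hb⟩⟩
  · exact .inl (congrArg Prod.fst (Option.some.inj (ha.symm.trans hb)))

theorem exists_holonomy_componentSubgraph {C : Γ.Component}
    (u v : {v : V | Γ.incidenceGraph.connectedComponentMk (.inl v) = C}) :
    ∃ c, (Γ.componentSubgraph C).Holonomy u v c := by
  have hreach : Γ.incidenceGraph.Reachable (.inl u.1) (.inl v.1) :=
    SimpleGraph.ConnectedComponent.exact (u.2.trans v.2.symm)
  suffices h : ∀ x, Γ.incidenceGraph.Reachable (.inl u.1) x →
      ∀ v (hv : Γ.incidenceGraph.connectedComponentMk (.inl v) = C),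
        (x = .inl v ∨ ∃ e, x = .inr e ∧ Γ.Incident v e) →
          ∃ c, (Γ.componentSubgraph C).Holonomy u ⟨v, hv⟩ c from
    h _ hreach v.1 v.2 (.inl rfl)
  intro x hx
  rw [SimpleGraph.reachable_iff_reflTransGen] at hx
  induction hx with
  | refl =>
    rintro v hv (h | ⟨e, h, -⟩)
    · obtain rfl : u = ⟨v, hv⟩ := Subtype.ext (Sum.inl_injective h)
      exact ⟨1, .refl _⟩
    · cases h
  | @tail x y _ hxy ih =>
    rintro v hv (rfl | ⟨e, rfl, hve⟩) <;> rcases x with w | f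
    · exact hxy.elim
    · exact ih v hv (.inr ⟨f, rfl, hxy⟩)
    · have hwe : Γ.Incident w e := hxy
      have he := hve.connectedComponentMk_eq.symm.trans hv
      obtain ⟨c, hc⟩ := ih w (hwe.connectedComponentMk_eq.trans he) (.inl rfl)
      rcases hwe.eq_or_link hve with rfl | ⟨a, b, hl⟩
      · exact ⟨c, hc⟩
      · exact ⟨_, hc.trans (Link.holonomy (e := ⟨e, he⟩) (link_subgraph_iff.2 hl))⟩
    · exact hxy.elim

theorem not_injective_γ_of_inEquilibrium {C : Γ.Component}
    (h : (Γ.componentSubgraph C).InEquilibrium) : ¬Function.Injective Γ.γ := by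
  obtain ⟨hfin, hleaf, hbal⟩ := h
  obtain ⟨u⟩ : Nonempty {v : V | Γ.incidenceGraph.connectedComponentMk (.inl v) = C} := by
    obtain ⟨u | e, hC⟩ := C.exists_rep
    · exact ⟨u, hC⟩
    · obtain ⟨u, -⟩ := exists_s_t_of_not_isLeaf (hleaf ⟨e, hC⟩)
      exact ⟨u⟩
  obtain ⟨k, hk, hk0⟩ := NNDCyclesBalanced.exists_isPotential hbal u
    (exists_holonomy_componentSubgraph u)
  obtain ⟨z, hz, hz0⟩ := hk.exists_int hk0
  have hker : Γ.γ ((Finsupp.equivFunOnFinite.symm z).mapDomain Subtype.val) = 0 :=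
    γ_mapDomain_val_eq_zero (fun v hv e he => he.connectedComponentMk_eq.symm.trans hv)
      (γ_eq_zero_of_isPotential hleaf hz)
  intro hinj
  have hzero := (map_eq_zero_iff Γ.γ hinj).1 hker
  refine hz0 u ?_
  simpa [Finsupp.mapDomain_apply Subtype.val_injective] using DFunLike.congr_fun hzero u.1

section kernel

variable {k : V →₀ ℤ}

theorem ne_zero_of_incident_of_incident (hk : Γ.γ k = 0) {v w : V} {e : E} (hv : Γ.Incident v e)
    (hw : Γ.Incident w e) (hkv : k v ≠ 0) : k w ≠ 0 := by
  rcases hv.eq_or_link hw with rfl | ⟨a, b, hl⟩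
  · exact hkv
  · have hprod : (a : ℤ) * k v ≠ 0 := mul_ne_zero (by simp) hkv
    rw [isPotential_intCast_iff.1 (isPotential_of_γ_eq_zero hk) hl] at hprod
    exact right_ne_zero_of_mul hprod

theorem not_isLeaf_of_incident (hk : Γ.γ k = 0) {v : V} {e : E} (h : Γ.Incident v e)
    (hkv : k v ≠ 0) : ¬Γ.IsLeaf e := by
  have he := γ_eq_zero_iff.1 hk e
  have hend : endVal k (Γ.t e) ≠ 0 := by
    rcases h with ⟨n, hs⟩ | ⟨n, ht⟩
    · exact he ▸ endVal_ne_zero_iff.2 ⟨v, n, hs, hkv⟩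
    · exact endVal_ne_zero_iff.2 ⟨v, n, ht, hkv⟩
  obtain ⟨w, n, ht, -⟩ := endVal_ne_zero_iff.1 hend
  obtain ⟨u, m, hs, -⟩ := endVal_ne_zero_iff.1 (he ▸ hend)
  simp [IsLeaf, hs, ht]

theorem exists_ne_zero_of_reachable (hk : Γ.γ k = 0) {u : V} (hu : k u ≠ 0) {x : V ⊕ E}
    (hx : Γ.incidenceGraph.Reachable (.inl u) x) :
    x.elim (fun v => k v ≠ 0) fun e => ∃ v, Γ.Incident v e ∧ k v ≠ 0 := by
  rw [SimpleGraph.reachable_iff_reflTransGen] at hx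
  induction hx with
  | refl => exact hu
  | @tail x y _ hxy ih =>
    rcases x with v | e <;> rcases y with w | f
    · exact hxy.elim
    · exact ⟨v, hxy, ih⟩
    · obtain ⟨v, hve, hv⟩ := ih
      exact ne_zero_of_incident_of_incident hk hve hxy hv
    · exact hxy.elim

theorem inEquilibrium_of_γ_eq_zero (hk : Γ.γ k = 0) {u : V} (hu : k u ≠ 0) :
    (Γ.componentSubgraph (Γ.incidenceGraph.connectedComponentMk (.inl u))).InEquilibrium := by
  have hvertex (v : V) (hv : Γ.incidenceGraph.connectedComponentMk (.inl v) =
      Γ.incidenceGraph.connectedComponentMk (.inl u)) : k v ≠ 0 :=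
    exists_ne_zero_of_reachable hk hu (SimpleGraph.ConnectedComponent.exact hv).symm
  refine ⟨(k.hasFiniteSupport.subset hvertex).to_subtype, ?_, fun V' E' hcycle => ?_⟩
  · rintro ⟨e, he⟩
    obtain ⟨v, hve, hv⟩ :=
      exists_ne_zero_of_reachable hk hu (SimpleGraph.ConnectedComponent.exact he).symm
    obtain ⟨v, m, w, n, hs, ht⟩ := exists_s_t_of_not_isLeaf (not_isLeaf_of_incident hk hve hv)
    have hl : Γ.Link e v w m n := .inl ⟨hs, ht⟩
    exact Link.not_isLeaf (u := ⟨v, hl.incident.connectedComponentMk_eq.trans he⟩)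
      (v := ⟨w, hl.symm.incident.connectedComponentMk_eq.trans he⟩) (link_subgraph_iff.2 hl)
  · exact hcycle.isBalancedNNDCycle (((isPotential_of_γ_eq_zero hk).subgraph _ _).subgraph V' E')
      fun v => by exact_mod_cast hvertex v.1 v.1.2

end kernel

theorem γ_injective_iff :
    Function.Injective Γ.γ ↔ ∀ C : Γ.Component, ¬(Γ.componentSubgraph C).InEquilibrium := by
  refine ⟨fun h C hC => not_injective_γ_of_inEquilibrium hC h, fun h => ?_⟩
  refine (injective_iff_map_eq_zero _).2 fun k hk => ?_
  ext u
  by_contra hu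
  exact h _ (inEquilibrium_of_γ_eq_zero hk hu)

end Multiquiver

end

theorem theorem4p5 {K V E : Type*} [Field K] [CharZero K] (Γ : Multiquiver V E) :
    (∃! φ : Γ.Alg K →ₐ[K] WeylAlgebra K E, Γ.IsCanonicalRep φ) ∧
    ∀ φ : Γ.Alg K →ₐ[K] WeylAlgebra K E, Γ.IsCanonicalRep φ →
      List.TFAE [
        Function.Injective φ,
        Function.Injective Γ.γ,
        Maximal (fun S : Subalgebra K (Γ.Alg K) => ∀ a ∈ S, ∀ b ∈ S, a * b = b * a) (Γ.ρ K).range,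
        ∀ C : Γ.Component, ¬(Γ.componentSubgraph C).InEquilibrium] := by
  refine ⟨⟨Γ.canonicalRep K, Γ.isCanonicalRep_canonicalRep K, fun φ hφ =>
    hφ.ext (Γ.isCanonicalRep_canonicalRep K)⟩, fun φ hφ => ?_⟩
  obtain rfl := hφ.ext (Γ.isCanonicalRep_canonicalRep K)
  tfae_have 1 → 2 := Γ.γ_injective_of_canonicalRep_injective K
  tfae_have 2 → 1 := Γ.canonicalRep_injective K
  tfae_have 3 → 2 := Γ.γ_injective_of_maximal K
  tfae_have 2 → 3 := Γ.maximal_of_γ_injective K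
  tfae_have 2 ↔ 4 := Multiquiver.γ_injective_iff
  tfae_finish
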